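/- For a graph $G$ on the vertex set $[n]=\{1,\dots,n\}$ and integers $1\le r\le d$, consider vectors $U_S$ (in some $\mathbb{R}^m$), one for each $S\subseteq[n]$ with $|S|\le r$, subject to the constraints - $\langle U_{\{i\}},U_{\{j\}}\rangle=0$ for all $i\ne j$ such that $\{i,j\}$ is not an edge of $G$; - $\langle U_{S_1},U_{S_2}\rangle=\langle U_{S_3},U_{S_4}\rangle$ whenever $|S_1|,\dots,|S_4|\le r$, $S_1\cup S_2=S_3\cup S_4$ and $|S_1\cup S_2|\le d$; - $\langle U_{S_1},U_{S_2}\rangle\in[0,1]$ whenever $|S_1|,|S_2|\le r$; - $\|U_\emptyset\|^2=1$. Let $\mathrm{SOS}_{r,d}(G)$ be the supremum of $\sum_{i=1}^n\|U_{\{i\}}\|^2$ over all such families. This is the value of the $r$-round SOS (Lasserre) relaxation of maximum clique on $G$, where $d$ is the size of unions up to which consistency is required: $d=r$ imposes it only for $|S_1\cup S_2|\le r$, and $d\ge 2r$ imposes it for all index sets of size at most $r$. The integrality gap on $G$ is $\mathrm{SOS}_{r,d}(G)/\omega(G)$, where $\omega(G)$ is the size of a largest clique of $G$. For $1\le t\le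 n$ let $G(n,1/2,t)$ be the law of the random graph obtained by drawing a graph from $G(n,1/2)$ and, independently, a uniformly random set of $t$ vertices, and adding all edges inside that set. **Corollary 1.2.** There is an absolute constant $C>0$ such that, with high probability, for $G\leftarrow G(n,1/2,t)$ the integrality gap of the $r$-round SOS relaxation of maximum clique is at least $\dfrac{n^{1/(2r)}}{t\,C^{r}(\log n)^2}$. Precisely: for every $\varepsilon>0$ there is an $N$ such that for all $n\ge N$, all $r\ge1$, all $d\ge r$ and all $1\le t\le n$, $$\Pr_{G\leftarrow G(n,1/2,t)}\left[\frac{\mathrm{SOS}_{r,d}(G)}{\omega(G)}\ \ge\ \frac{n^{1/(2r)}}{t\,C^{r}(\log n)^2}\right]\ \ge\ 1-\varepsilon .$$ -/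

import Mathlib

open MeasureTheory
open scoped ENNReal

/-- Feasibility for the `r`-round SOS (Lasserre) relaxation of maximum clique on `G`.
The variables are vectors `U S` for `S ⊆ V`, `|S| ≤ r` (values of `U` on larger sets are not
constrained and not used). The consistency constraint is imposed for `|S₁ ∪ S₂| ≤ d`; as all the
sets have at most `r` elements, it is imposed without restriction as soon as `d ≥ 2 * r`. -/
structure IsSOSCliqueSolution {V : Type*} [DecidableEq V] (G : SimpleGraph V) (r d : ℕ)
    {m : ℕ} (U : Finset V → EuclideanSpace ℝ (Fin m)) : Prop where
  edge : ∀ i j : V, i ≠ j → ¬ G.Adj i j → inner ℝ (U {i}) (U {j}) = 0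
  consistent : ∀ S₁ S₂ S₃ S₄ : Finset V,
    S₁.card ≤ r → S₂.card ≤ r → S₃.card ≤ r → S₄.card ≤ r →
    S₁ ∪ S₂ = S₃ ∪ S₄ → (S₁ ∪ S₂).card ≤ d →
    inner ℝ (U S₁) (U S₂) = inner ℝ (U S₃) (U S₄)
  mem_Icc : ∀ S₁ S₂ : Finset V, S₁.card ≤ r → S₂.card ≤ r →
    inner ℝ (U S₁) (U S₂) ∈ Set.Icc (0 : ℝ) 1
  unit : ‖U ∅‖ ^ 2 = 1

/-- The objective values `∑ i, ‖U {i}‖ ^ 2` of the feasible vector solutions, in any finite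
dimension. -/
def sosCliqueObjectives {V : Type*} [Fintype V] [DecidableEq V] (G : SimpleGraph V)
    (r d : ℕ) : Set ℝ :=
  {v | ∃ (m : ℕ) (U : Finset V → EuclideanSpace ℝ (Fin m)),
    IsSOSCliqueSolution G r d U ∧ v = ∑ i, ‖U {i}‖ ^ 2}

theorem sosCliqueObjectives_nonempty {V : Type*} [Fintype V] [DecidableEq V]
    (G : SimpleGraph V) (r d : ℕ) : (sosCliqueObjectives G r d).Nonempty := by
  have h : ∀ A B : Finset V,
      inner ℝ (if A = ∅ then EuclideanSpace.single (0 : Fin 1) (1 : ℝ) else 0)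
        (if B = ∅ then EuclideanSpace.single (0 : Fin 1) (1 : ℝ) else 0)
        = if A ∪ B = ∅ then (1 : ℝ) else 0 := by
    intro A B
    by_cases hA : A = ∅ <;> by_cases hB : B = ∅ <;> simp [hA, hB]
  refine ⟨_, 1, fun S => if S = ∅ then EuclideanSpace.single 0 1 else 0, ⟨?_, ?_, ?_, ?_⟩, rfl⟩
  · intro i j _ _
    simp
  · intro S₁ S₂ S₃ S₄ _ _ _ _ hS _
    rw [h, h, hS]
  · intro S₁ S₂ _ _
    rw [h]
    split_ifs <;> simp
  · simp

theorem sosCliqueObjectives_bddAbove {V : Type*} [Fintype V] [DecidableEq V]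
    (G : SimpleGraph V) {r : ℕ} (hr : 1 ≤ r) (d : ℕ) : BddAbove (sosCliqueObjectives G r d) := by
  refine ⟨∑ _i : V, 1, ?_⟩
  rintro v ⟨m, U, hU, rfl⟩
  refine Finset.sum_le_sum fun i _ => ?_
  have := (hU.mem_Icc {i} {i} (by simpa using hr) (by simpa using hr)).2
  rwa [real_inner_self_eq_norm_sq] at this

/-- The value of the `r`-round relaxation. -/
noncomputable def sosCliqueValue {V : Type*} [Fintype V] [DecidableEq V]
    (G : SimpleGraph V) (r d : ℕ) : ℝ :=
  sSup (sosCliqueObjectives G r d)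

/-- The integrality gap on `G`: the value of the relaxation over the size of a largest clique. -/
noncomputable def sosCliqueGap {V : Type*} [Fintype V] [DecidableEq V]
    (G : SimpleGraph V) (r d : ℕ) : ℝ :=
  sosCliqueValue G r d / (G.cliqueNum : ℝ)

/-- The graph whose edges are exactly the pairs of distinct vertices in `S`. -/
def cliqueOn {V : Type*} (S : Finset V) : SimpleGraph V where
  Adj i j := i ≠ j ∧ i ∈ S ∧ j ∈ S
  symm := ⟨fun _ _ h => ⟨h.1.symm, h.2.2, h.2.1⟩⟩
  loopless := ⟨fun _ h => h.1 rfl⟩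

/-- The law `G(n, 1/2)`. -/
noncomputable def randomGraph (n : ℕ) : Measure (SimpleGraph (Fin n)) :=
  SimpleGraph.binomialRandom (Fin n) ⟨1 / 2, by norm_num, by norm_num⟩

/-- The law `G(n, 1/2, t)` (for `t ≤ n`): draw a graph from `G(n, 1/2)` and, independently, a
uniformly random set of `t` vertices, and add all the edges inside that set. -/
noncomputable def plantedClique (n t : ℕ) : Measure (SimpleGraph (Fin n)) :=
  ((n.choose t : ℕ) : ℝ≥0∞)⁻¹ •
    ∑ S ∈ (Finset.univ : Finset (Fin n)).powersetCard t,
      (randomGraph n).map (fun G => G ⊔ cliqueOn S)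

theorem isProbabilityMeasure_plantedClique {n t : ℕ} (ht : t ≤ n) :
    IsProbabilityMeasure (plantedClique n t) := by
  have h1 : IsProbabilityMeasure (randomGraph n) := by unfold randomGraph; infer_instance
  have hs : MeasurableSingletonClass (SimpleGraph (Fin n)) := ⟨fun G => by
    have h : (SimpleGraph.edgeSet ⁻¹' {G.edgeSet} : Set (SimpleGraph (Fin n))) = {G} := by
      ext H
      simp
    rw [← h]
    exact SimpleGraph.measurableEmbedding_edgeSet.measurable (measurableSet_singleton _)⟩
  have h2 : ∀ S : Finset (Fin n),
      IsProbabilityMeasure ((randomGraph n).map (fun G => G ⊔ cliqueOn S)) := fun S =>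
    Measure.isProbabilityMeasure_map (measurable_of_finite _).aemeasurable
  have h3 : n.choose t ≠ 0 := (Nat.choose_pos ht).ne'
  refine ⟨?_⟩
  simp only [plantedClique, Measure.smul_apply, Measure.finsetSum_apply, measure_univ,
    Finset.sum_const, Finset.card_powersetCard, Finset.card_univ, Fintype.card_fin, smul_eq_mul,
    nsmul_eq_mul, mul_one]
  exact ENNReal.inv_mul_cancel (by exact_mod_cast h3) (by simp)

/-! ### Weighted sums over supersets -/

section SubsetSums

variable {V : Type*} [Fintype V] [DecidableEq V]

/-! The witness is the naive pseudo-expectation: with `p = k / n`, a clique `S` gets moment `p ^ |S|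
* 2 ^ (|S| choose 2)`, every other set gets `0`, and the objective is `k`. The moment depends only
on the union, so consistency holds for every `d`; the point is positive semidefiniteness on sets of
size at most `r`.

With `χ` the `±1` adjacency matrix, the moment of `I ∪ J` factors (`pseudoMoment_union`) as a
function of `I`, times a function of `J`, times `f |I ∩ J|`, times the product of `1 + χ` over `(I \
J) × (J \ I)`. The first two are absorbed into the test vector `v`. Replacing `χ` by `τ χ`
interpolates from an explicit form at `τ = 0` to the moment form at `τ = 1`, and both ends are
compared through `W = ∑ N ^ |I| * v I ^ 2`, where `N = n`.

At `τ = 0` the kernel `f |I ∩ J|` is a positive combination of squares, because `f` grows fast;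
Möbius inversion bounds the form below by a multiple of `W` of order `k ^ (-r)`. The `τ`-derivative
singles out one pair `(i, j)`; once it is removed, what remains is a bilinear form in `χ`, bounded
by the operator norm `K`, and the lost vertex gains a factor `N`, so the derivative is of order `(K
/ N) * W`. The mean value theorem (`crossForm_one_nonneg`) then asks for `K * k ^ r ≲ n`. A net
argument gives `K ≤ 37 √n` with high probability, hence `k` of order `n ^ (1 / (2 r))` up to `C ^
r`.

Planting a clique only deletes constraints, and raises the clique number, which is `O(log n)`, by at
most `t`. -/

theorem sum_superset_inv_pow_le (I : Finset V) {N : ℝ} (hN : N = Fintype.card V) (hN1 : 1 ≤ N) :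
    ∑ J : Finset V with I ⊆ J, (N ^ (J \ I).card)⁻¹ ≤ 3 := by
  have h1 : ∑ J : Finset V with I ⊆ J, (N ^ (J \ I).card)⁻¹
      ≤ ∑ B ∈ (Finset.univ : Finset V).powerset, (N⁻¹) ^ B.card := by
    rw [← Finset.sum_image (s := Finset.univ.filter fun J : Finset V => I ⊆ J)
      (g := fun J => J \ I) (f := fun B => (N⁻¹) ^ B.card) (by
        intro A hA B hB h
        simp only [Finset.coe_filter, Finset.mem_univ, true_and, Set.mem_ofPred_eq] at hA hB
        rw [← Finset.sdiff_union_of_subset hA, ← Finset.sdiff_union_of_subset hB]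
        exact congrArg (· ∪ I) h) |>.trans (Finset.sum_congr rfl fun J _ => by rw [inv_pow])]
    exact Finset.sum_le_sum_of_subset_of_nonneg (fun _ _ => by simp)
      fun _ _ _ => by positivity
  -- By the binomial theorem the sum is `(1 + 1 / N) ^ N ≤ e < 3`.
  refine h1.trans ?_
  have h2 := Finset.sum_pow_mul_eq_add_pow N⁻¹ 1 (Finset.univ : Finset V)
  simp only [one_pow, mul_one] at h2
  rw [h2, Finset.card_univ]
  calc (N⁻¹ + 1) ^ Fintype.card V ≤ (Real.exp N⁻¹) ^ Fintype.card V := by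
        gcongr
        exact Real.add_one_le_exp _
    _ = Real.exp 1 := by
        rw [← Real.exp_nat_mul, ← hN, mul_inv_cancel₀ (by positivity)]
    _ ≤ 3 := Real.exp_one_lt_three.le

/-- Weighted Cauchy–Schwarz over the supersets of a set. -/
theorem sq_sum_superset_le (I : Finset V) {N : ℝ} (hN : N = Fintype.card V) (hN1 : 1 ≤ N)
    (y : Finset V → ℝ) :
    (∑ J : Finset V with I ⊆ J, y J) ^ 2
      ≤ 3 * ∑ J : Finset V with I ⊆ J, N ^ (J \ I).card * y J ^ 2 := by
  refine (Finset.sum_sq_le_sum_mul_sum_of_sq_le_mul _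
    (f := fun J => (N ^ (J \ I).card)⁻¹) (g := fun J => N ^ (J \ I).card * y J ^ 2)
    (fun J _ => by positivity) (fun J _ => by positivity) (fun J _ => ?_)).trans ?_
  · exact le_of_eq (by field_simp)
  · exact mul_le_mul_of_nonneg_right (sum_superset_inv_pow_le I hN hN1)
      (Finset.sum_nonneg fun J _ => by positivity)

theorem pow_card_sdiff_mul {V : Type*} [DecidableEq V] {N : ℝ} {I J : Finset V} (h : I ⊆ J) :
    N ^ I.card * N ^ (J \ I).card = N ^ J.card := by
  rw [← pow_add, add_comm, Finset.card_sdiff_add_card_eq_card h]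

theorem sum_sum_superset_comm (F : Finset V → Finset V → ℝ) :
    ∑ I : Finset V, ∑ J : Finset V with I ⊆ J, F I J
      = ∑ J : Finset V, ∑ I ∈ J.powerset, F I J := by
  rw [Finset.sum_comm' (t' := Finset.univ) (s' := fun J => J.powerset)]
  simp

/-- After Cauchy–Schwarz the weights combine to `N ^ |J|`, and each `J` is counted once for each of
its `2 ^ |J|` subsets. -/
theorem sum_pow_mul_sq_sum_superset_le {N : ℝ} (hN : N = Fintype.card V) (hN1 : 1 ≤ N)
    (y : Finset V → ℝ) :
    ∑ I : Finset V, N ^ I.card * (∑ J : Finset V with I ⊆ J, y J) ^ 2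
      ≤ 3 * ∑ J : Finset V, 2 ^ J.card * (N ^ J.card * y J ^ 2) := by
  calc _ ≤ ∑ I : Finset V, N ^ I.card *
        (3 * ∑ J : Finset V with I ⊆ J, N ^ (J \ I).card * y J ^ 2) := by
        gcongr with I
        exact sq_sum_superset_le I hN hN1 y
    _ = 3 * ∑ I : Finset V, ∑ J : Finset V with I ⊆ J, N ^ J.card * y J ^ 2 := by
        rw [Finset.mul_sum]
        refine Finset.sum_congr rfl fun I _ => ?_
        rw [← mul_assoc, mul_comm (N ^ I.card), mul_assoc, Finset.mul_sum]
        congr 1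
        refine Finset.sum_congr rfl fun J hJ => ?_
        rw [← mul_assoc, pow_card_sdiff_mul (Finset.mem_filter.1 hJ).2]
    _ = _ := by
        rw [sum_sum_superset_comm]
        congr 1
        refine Finset.sum_congr rfl fun J _ => ?_
        rw [Finset.sum_const, Finset.card_powerset, nsmul_eq_mul]
        push_cast
        rfl

theorem sum_neg_one_pow_card_between {V : Type*} [DecidableEq V] (I L : Finset V) :
    ∑ J ∈ L.powerset with I ⊆ J, (-1 : ℝ) ^ (J \ I).card = if I = L then 1 else 0 := by
  by_cases hIL : I ⊆ L
  · have h : ∑ J ∈ L.powerset with I ⊆ J, (-1 : ℝ) ^ (J \ I).card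
        = ∑ B ∈ (L \ I).powerset, (-1 : ℝ) ^ B.card := by
      refine Finset.sum_nbij' (fun J => J \ I) (fun B => B ∪ I) ?_ ?_ ?_ ?_ ?_
      · intro J hJ
        simp only [Finset.mem_filter, Finset.mem_powerset] at hJ ⊢
        exact Finset.sdiff_subset_sdiff hJ.1 le_rfl
      · intro B hB
        simp only [Finset.mem_filter, Finset.mem_powerset] at hB ⊢
        exact ⟨Finset.union_subset (hB.trans Finset.sdiff_subset) hIL,
          Finset.subset_union_right⟩
      · intro J hJ
        simp only [Finset.mem_filter, Finset.mem_powerset] at hJ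
        exact Finset.sdiff_union_of_subset hJ.2
      · intro B hB
        simp only [Finset.mem_powerset] at hB
        refine Finset.union_sdiff_cancel_right ?_
        exact Finset.disjoint_of_subset_left hB Finset.sdiff_disjoint
      · intro J _
        rfl
    rw [h]
    have h2 := congrArg (fun z : ℤ => (z : ℝ))
      (Finset.sum_powerset_neg_one_pow_card (x := L \ I))
    push_cast at h2
    rw [h2]
    have : L \ I = ∅ ↔ I = L := by
      rw [Finset.sdiff_eq_empty_iff_subset]
      exact ⟨fun h => hIL.antisymm h, fun h => h ▸ le_rfl⟩
    simp only [this]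
  · rw [if_neg (by rintro rfl; exact hIL le_rfl), Finset.sum_eq_zero]
    intro J hJ
    simp only [Finset.mem_filter, Finset.mem_powerset] at hJ
    exact absurd (hJ.2.trans hJ.1) hIL

/-- Möbius inversion over supersets. -/
theorem eq_sum_superset_neg_one_pow (v : Finset V → ℝ) (I : Finset V) :
    v I = ∑ J : Finset V with I ⊆ J,
      (-1 : ℝ) ^ (J \ I).card * ∑ L : Finset V with J ⊆ L, v L := by
  simp_rw [Finset.mul_sum]
  rw [Finset.sum_comm' (t' := Finset.univ)
    (s' := fun L => L.powerset.filter fun J => I ⊆ J)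
    (by intro x y; simp [and_comm])]
  simp_rw [← Finset.sum_mul, sum_neg_one_pow_card_between]
  simp

/-- Möbius inversion expresses `v` through its superset sums; absolute values remove the signs, and
the preceding inequality applies to these sums. This is the coercivity used at `τ = 0`. -/
theorem sum_pow_mul_sq_le {N : ℝ} (hN : N = Fintype.card V) (hN1 : 1 ≤ N) (v : Finset V → ℝ) :
    ∑ I : Finset V, N ^ I.card * v I ^ 2
      ≤ 3 * ∑ J : Finset V, 2 ^ J.card *
        (N ^ J.card * (∑ L : Finset V with J ⊆ L, v L) ^ 2) := by
  calc ∑ I : Finset V, N ^ I.card * v I ^ 2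
      = ∑ I : Finset V, N ^ I.card * (∑ J : Finset V with I ⊆ J,
        (-1 : ℝ) ^ (J \ I).card * ∑ L : Finset V with J ⊆ L, v L) ^ 2 := by
        refine Finset.sum_congr rfl fun I _ => ?_
        rw [← eq_sum_superset_neg_one_pow]
    _ ≤ ∑ I : Finset V, N ^ I.card * (∑ J : Finset V with I ⊆ J,
        |∑ L : Finset V with J ⊆ L, v L|) ^ 2 := by
        refine Finset.sum_le_sum fun I _ => mul_le_mul_of_nonneg_left ?_ (by positivity)
        rw [sq_le_sq]
        refine (Finset.abs_sum_le_sum_abs _ _).trans ((le_abs_self _).trans' ?_)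
        refine Finset.sum_le_sum fun J _ => ?_
        rw [abs_mul, abs_pow, abs_neg, abs_one, one_pow, one_mul]
    _ ≤ _ := by
        refine (sum_pow_mul_sq_sum_superset_le hN hN1 _).trans_eq ?_
        simp_rw [sq_abs]

/-- For nonnegative `X`, enlarging `N ^ |I ∩ J|` to the sum of `N ^ |K|` over `K ⊆ I ∩ J` turns the
form into a weighted sum of squares of superset sums. -/
theorem sum_sum_pow_card_inter_le {N : ℝ} (hN : N = Fintype.card V) (hN1 : 1 ≤ N)
    (X : Finset V → ℝ) (hX : ∀ I, 0 ≤ X I) :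
    ∑ I, ∑ J, N ^ (I ∩ J).card * (X I * X J)
      ≤ 3 * ∑ J : Finset V, 2 ^ J.card * (N ^ J.card * X J ^ 2) := by
  refine le_trans ?_ (sum_pow_mul_sq_sum_superset_le hN hN1 X)
  calc ∑ I, ∑ J, N ^ (I ∩ J).card * (X I * X J)
      ≤ ∑ I, ∑ J, ∑ K ∈ (I ∩ J).powerset, N ^ K.card * (X I * X J) := by
        gcongr with I _ J
        exact Finset.single_le_sum (f := fun K : Finset V => N ^ K.card * (X I * X J))
          (fun K _ => mul_nonneg (by positivity) (mul_nonneg (hX I) (hX J)))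
          (Finset.mem_powerset_self _)
    _ = ∑ K : Finset V, N ^ K.card * (∑ J : Finset V with K ⊆ J, X J) ^ 2 := by
        simp_rw [sq, Finset.sum_mul_sum, Finset.mul_sum]
        have h : ∀ (S : Finset V) (F : Finset V → ℝ),
            ∑ K ∈ S.powerset, F K = ∑ K, if K ⊆ S then F K else 0 := by
          intro S F
          rw [← Finset.sum_filter]
          exact Finset.sum_congr (by ext; simp) fun _ _ => rfl
        simp_rw [Finset.sum_filter, h, Finset.subset_inter_iff, ite_and]
        rw [Finset.sum_congr rfl fun I _ => Finset.sum_comm, Finset.sum_comm]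
        refine Finset.sum_congr rfl fun K _ => Finset.sum_congr rfl fun I _ => ?_
        split_ifs <;> simp

end SubsetSums

/-! ### Interpolation of the form in `τ` -/

section CrossForm

variable {V : Type*} [Fintype V] [DecidableEq V]

/-- `χ` has operator norm at most `K`. -/
def BilinBound (χ : V → V → ℝ) (K : ℝ) : Prop :=
  ∀ x y : V → ℝ, |∑ i, ∑ j, χ i j * (x i * y j)| ≤ K * (√(∑ i, x i ^ 2) * √(∑ j, y j ^ 2))

/-- The form with kernel `f (#(I ∩ J)) * ∏ (1 + τ χ)`, the product being over the pairs of
`(I \ J) × (J \ I)`. -/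
def crossForm (χ : V → V → ℝ) (f : ℕ → ℝ) (v : Finset V → ℝ) (τ : ℝ) : ℝ :=
  ∑ I, ∑ J, v I * v J * f (I ∩ J).card * ∏ e ∈ (I \ J) ×ˢ (J \ I), (1 + τ * χ e.1 e.2)

def crossFormDeriv (χ : V → V → ℝ) (f : ℕ → ℝ) (v : Finset V → ℝ) (τ : ℝ) : ℝ :=
  ∑ I, ∑ J, v I * v J * f (I ∩ J).card * ∑ e ∈ (I \ J) ×ˢ (J \ I),
    (∏ e' ∈ ((I \ J) ×ˢ (J \ I)).erase e, (1 + τ * χ e'.1 e'.2)) * χ e.1 e.2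

theorem hasDerivAt_crossForm (χ : V → V → ℝ) (f : ℕ → ℝ) (v : Finset V → ℝ) (τ : ℝ) :
    HasDerivAt (crossForm χ f v) (crossFormDeriv χ f v τ) τ := by
  unfold crossForm crossFormDeriv
  refine HasDerivAt.fun_sum fun I _ => HasDerivAt.fun_sum fun J _ => HasDerivAt.const_mul _ ?_
  have h := HasDerivAt.fun_finsetProd (u := (I \ J) ×ˢ (J \ I))
    (f := fun e (τ : ℝ) => 1 + τ * χ e.1 e.2) (f' := fun e => χ e.1 e.2) (x := τ)
    (fun e _ => by simpa using ((hasDerivAt_id τ).mul_const (χ e.1 e.2)).const_add 1)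
  simpa only [smul_eq_mul] using h

theorem insert_product_insert_erase {V : Type*} [DecidableEq V] {A B : Finset V} {i j : V} (hi : i ∉ A) (hj : j ∉ B)
    (g : V × V → ℝ) :
    ∏ e ∈ (insert i A ×ˢ insert j B).erase (i, j), g e
      = (∏ e ∈ A ×ˢ B, g e) * ((∏ b ∈ B, g (i, b)) * ∏ a ∈ A, g (a, j)) := by
  have h : (insert i A ×ˢ insert j B).erase (i, j)
      = (A ×ˢ B) ∪ (({i} ×ˢ B) ∪ (A ×ˢ {j})) := by
    ext ⟨a, b⟩
    simp only [Finset.mem_erase, Finset.mem_product, Finset.mem_insert, Finset.mem_union,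
      Finset.mem_singleton, ne_eq, Prod.mk.injEq]
    grind
  rw [h, Finset.prod_union, Finset.prod_union, Finset.prod_product ({i} : Finset V),
    Finset.prod_product A {j}]
  · simp
  · rw [Finset.disjoint_left]
    rintro ⟨a, b⟩
    simp only [Finset.mem_product, Finset.mem_singleton]
    grind
  · rw [Finset.disjoint_left]
    rintro ⟨a, b⟩
    simp only [Finset.mem_product, Finset.mem_singleton, Finset.mem_union]
    grind

/-- Summing over pairs of sets with one marked element in each difference is summing over the
pairs of sets left when the marked elements are removed. -/
theorem sum_marked_eq (F : Finset V → Finset V → V → V → ℝ) :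
    ∑ I : Finset V, ∑ J : Finset V, ∑ e ∈ (I \ J) ×ˢ (J \ I), F I J e.1 e.2
      = ∑ I : Finset V, ∑ J : Finset V, ∑ i, ∑ j,
        if i ∉ I ∧ i ∉ J ∧ j ∉ I ∧ j ∉ J ∧ i ≠ j then F (insert i I) (insert j J) i j else 0 := by
  have h1 : ∀ I J : Finset V, ∑ e ∈ (I \ J) ×ˢ (J \ I), F I J e.1 e.2
      = ∑ i, ∑ j, if i ∈ I \ J ∧ j ∈ J \ I then F I J i j else 0 := by
    intro I J
    rw [← Finset.sum_product', Finset.univ_product_univ, ← Finset.sum_filter]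
    refine Finset.sum_congr ?_ fun _ _ => rfl
    ext ⟨i, j⟩
    simp
  simp_rw [h1]
  have h2 : ∀ G : Finset V → Finset V → V → V → ℝ, ∑ I, ∑ J, ∑ i, ∑ j, G I J i j
      = ∑ q : Finset V × Finset V × V × V, G q.1 q.2.1 q.2.2.1 q.2.2.2 := by
    intro G
    simp_rw [Fintype.sum_prod_type]
  rw [h2, h2, ← Finset.sum_filter, ← Finset.sum_filter]
  refine Finset.sum_nbij' (fun q => (q.1.erase q.2.2.1, q.2.1.erase q.2.2.2, q.2.2))
    (fun q => (insert q.2.2.1 q.1, insert q.2.2.2 q.2.1, q.2.2)) ?_ ?_ ?_ ?_ ?_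
  · rintro ⟨I, J, i, j⟩ h
    simp only [Finset.mem_filter, Finset.mem_univ, true_and, Finset.mem_sdiff,
      Finset.mem_erase] at h ⊢
    grind
  · rintro ⟨I, J, i, j⟩ h
    simp only [Finset.mem_filter, Finset.mem_univ, true_and, Finset.mem_sdiff,
      Finset.mem_insert] at h ⊢
    grind
  · rintro ⟨I, J, i, j⟩ h
    simp only [Finset.mem_filter, Finset.mem_univ, true_and, Finset.mem_sdiff] at h
    simp [Finset.insert_erase h.1.1, Finset.insert_erase h.2.1]
  · rintro ⟨I, J, i, j⟩ h
    simp only [Finset.mem_filter, Finset.mem_univ, true_and] at h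
    simp [Finset.erase_insert h.1, Finset.erase_insert h.2.2.2.1]
  · rintro ⟨I, J, i, j⟩ h
    simp only [Finset.mem_filter, Finset.mem_univ, true_and, Finset.mem_sdiff] at h
    simp [Finset.insert_erase h.1.1, Finset.insert_erase h.2.1]

/-- The `ℓ²` norm of `i ↦ v (I ∪ {i})` over the `i ∉ I`. -/
noncomputable def linkNorm (v : Finset V → ℝ) (I : Finset V) : ℝ :=
  √(∑ i, if i ∉ I then v (insert i I) ^ 2 else 0)

theorem linkNorm_nonneg (v : Finset V → ℝ) (I : Finset V) : 0 ≤ linkNorm v I :=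
  Real.sqrt_nonneg _

theorem linkNorm_eq_zero {v : Finset V → ℝ} {r : ℕ} (hv : ∀ I, r < I.card → v I = 0)
    {I : Finset V} (hI : r ≤ I.card) : linkNorm v I = 0 := by
  unfold linkNorm
  rw [Finset.sum_eq_zero, Real.sqrt_zero]
  intro i _
  split_ifs with h
  · rfl
  · rw [hv _ (by rw [Finset.card_insert_of_notMem h]; omega)]
    simp

theorem abs_prod_one_add_le {ι : Type*} (s : Finset ι) (g : ι → ℝ) {τ : ℝ}
    (hτ : τ ∈ Set.Icc (0 : ℝ) 1) (hg : ∀ i, |g i| ≤ 1) {m : ℕ} (hm : s.card ≤ m) :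
    |∏ i ∈ s, (1 + τ * g i)| ≤ 2 ^ m := by
  rw [Finset.abs_prod]
  calc ∏ i ∈ s, |1 + τ * g i| ≤ ∏ _i ∈ s, (2 : ℝ) := by
        refine Finset.prod_le_prod (fun _ _ => abs_nonneg _) fun i _ => ?_
        refine (abs_add_le _ _).trans ?_
        rw [abs_one, abs_mul, abs_of_nonneg hτ.1]
        nlinarith [hg i, hτ.1, hτ.2, abs_nonneg (g i)]
    _ = 2 ^ s.card := by simp
    _ ≤ 2 ^ m := pow_le_pow_right₀ (by norm_num) hm

/-- Once the marked `i` and `j` are deleted, the other pairs split into those avoiding both, those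
through `i` and those through `j`. The inner sum thus becomes a bilinear form in `χ` with one vector
indexed by `i` and one by `j`. The terms `i = j` are harmless since `χ i i = 0`. -/
theorem crossFormDeriv_eq (χ : V → V → ℝ) (f : ℕ → ℝ) (v : Finset V → ℝ) (τ : ℝ)
    (hχ0 : ∀ i, χ i i = 0) :
    crossFormDeriv χ f v τ = ∑ I : Finset V, ∑ J : Finset V, f (I ∩ J).card *
      ((∏ e ∈ (I \ J) ×ˢ (J \ I), (1 + τ * χ e.1 e.2)) * ∑ i, ∑ j, χ i j *
        ((if i ∉ I ∧ i ∉ J then (∏ b ∈ J \ I, (1 + τ * χ i b)) * v (insert i I) else 0) *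
        (if j ∉ I ∧ j ∉ J then (∏ a ∈ I \ J, (1 + τ * χ a j)) * v (insert j J) else 0))) := by
  unfold crossFormDeriv
  simp_rw [Finset.mul_sum]
  rw [sum_marked_eq (fun I J i j => v I * v J * f (I ∩ J).card *
    ((∏ e' ∈ ((I \ J) ×ˢ (J \ I)).erase (i, j), (1 + τ * χ e'.1 e'.2)) * χ i j))]
  refine Finset.sum_congr rfl fun I _ => Finset.sum_congr rfl fun J _ =>
    Finset.sum_congr rfl fun i _ => Finset.sum_congr rfl fun j _ => ?_
  by_cases hi : i ∉ I ∧ i ∉ J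
  · by_cases hj : j ∉ I ∧ j ∉ J
    · by_cases hij : i = j
      · subst hij
        simp [hχ0]
      · rw [if_pos ⟨hi.1, hi.2, hj.1, hj.2, hij⟩, if_pos hi, if_pos hj]
        have e1 : insert i I \ insert j J = insert i (I \ J) := by grind
        have e2 : insert j J \ insert i I = insert j (J \ I) := by grind
        have e3 : insert i I ∩ insert j J = I ∩ J := by grind
        rw [e1, e2, e3, insert_product_insert_erase (by grind) (by grind)]
        ring
    · rw [if_neg hj, if_neg (by tauto)]
      simp
  · rw [if_neg hi, if_neg (by tauto)]
    simp

theorem sqrt_sum_sq_link_le (v : Finset V → ℝ) (I J : Finset V) (α : V → ℝ) {m : ℕ}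
    (hα : ∀ i, |α i| ≤ 2 ^ m) :
    √(∑ i, (if i ∉ I ∧ i ∉ J then α i * v (insert i I) else 0) ^ 2)
      ≤ 2 ^ m * linkNorm v I := by
  unfold linkNorm
  rw [← Real.sqrt_sq (show (0 : ℝ) ≤ 2 ^ m by positivity), ← Real.sqrt_mul (by positivity)]
  refine Real.sqrt_le_sqrt ?_
  rw [Finset.mul_sum]
  refine Finset.sum_le_sum fun i _ => ?_
  by_cases hI : i ∉ I
  · by_cases hJ : i ∉ J
    · rw [if_pos ⟨hI, hJ⟩, if_pos hI, mul_pow]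
      refine mul_le_mul_of_nonneg_right ?_ (sq_nonneg _)
      rw [sq_le_sq, abs_of_nonneg (show (0 : ℝ) ≤ 2 ^ m by positivity)]
      exact hα i
    · rw [if_neg (by tauto), if_pos hI, zero_pow two_ne_zero]
      positivity
  · rw [if_neg (by tauto), if_neg hI]
    simp

/-- The power of two collects at most `r ^ 2` factors from the product over pairs and at most `r`
from each of the two vectors. -/
theorem abs_crossFormDeriv_le {χ : V → V → ℝ} {f : ℕ → ℝ} {v : Finset V → ℝ} {τ K N : ℝ} {r : ℕ}
    (hτ : τ ∈ Set.Icc (0 : ℝ) 1) (hχ0 : ∀ i, χ i i = 0) (hχ1 : ∀ i j, |χ i j| ≤ 1)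
    (hK0 : 0 ≤ K) (hK : BilinBound χ K) (hf0 : ∀ s ≤ r, 0 ≤ f s) (hf : ∀ s ≤ r, f s ≤ N ^ s)
    (hv : ∀ I, r < I.card → v I = 0) :
    |crossFormDeriv χ f v τ| ≤ K * 2 ^ (r ^ 2 + 2 * r) *
      ∑ I : Finset V, ∑ J : Finset V, N ^ (I ∩ J).card * (linkNorm v I * linkNorm v J) := by
  rw [crossFormDeriv_eq χ f v τ hχ0, Finset.mul_sum]
  refine (Finset.abs_sum_le_sum_abs _ _).trans (Finset.sum_le_sum fun I _ => ?_)
  rw [Finset.mul_sum]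
  refine (Finset.abs_sum_le_sum_abs _ _).trans (Finset.sum_le_sum fun J _ => ?_)
  have key : ∀ m : ℕ, I.card ≤ m → J.card ≤ m →
      |∑ i, ∑ j, χ i j *
        ((if i ∉ I ∧ i ∉ J then (∏ b ∈ J \ I, (1 + τ * χ i b)) * v (insert i I) else 0) *
        (if j ∉ I ∧ j ∉ J then (∏ a ∈ I \ J, (1 + τ * χ a j)) * v (insert j J) else 0))|
      ≤ K * ((2 ^ m * linkNorm v I) * (2 ^ m * linkNorm v J)) := by
    intro m hI hJ
    refine (hK _ _).trans (mul_le_mul_of_nonneg_left ?_ hK0)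
    refine mul_le_mul ?_ ?_ (Real.sqrt_nonneg _)
      (mul_nonneg (by positivity) (linkNorm_nonneg _ _))
    · exact sqrt_sum_sq_link_le v I J _ fun i => abs_prod_one_add_le _ _ hτ (hχ1 i)
        ((Finset.card_le_card Finset.sdiff_subset).trans hJ)
    · have := sqrt_sum_sq_link_le v J I (fun j => ∏ a ∈ I \ J, (1 + τ * χ a j)) (m := m)
        fun j => abs_prod_one_add_le _ _ hτ (fun a => hχ1 a j)
        ((Finset.card_le_card Finset.sdiff_subset).trans hI)
      simpa only [and_comm] using this
  by_cases hIJ : I.card ≤ r ∧ J.card ≤ r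
  · have hs : (I ∩ J).card ≤ r := (Finset.card_le_card Finset.inter_subset_left).trans hIJ.1
    have hp : |∏ e ∈ (I \ J) ×ˢ (J \ I), (1 + τ * χ e.1 e.2)| ≤ 2 ^ r ^ 2 := by
      refine abs_prod_one_add_le _ (fun e : V × V => χ e.1 e.2) hτ (fun e => hχ1 _ _) ?_
      rw [Finset.card_product, sq]
      exact Nat.mul_le_mul ((Finset.card_le_card Finset.sdiff_subset).trans hIJ.1)
        ((Finset.card_le_card Finset.sdiff_subset).trans hIJ.2)
    rw [abs_mul, abs_mul, abs_of_nonneg (hf0 _ hs)]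
    calc _ ≤ N ^ (I ∩ J).card *
          (2 ^ r ^ 2 * (K * ((2 ^ r * linkNorm v I) * (2 ^ r * linkNorm v J)))) := by
          refine mul_le_mul (hf _ hs) ?_ (by positivity) ((hf0 _ hs).trans (hf _ hs))
          exact mul_le_mul hp (key r hIJ.1 hIJ.2) (abs_nonneg _) (by positivity)
      _ = _ := by ring
  · have hz : linkNorm v I * linkNorm v J = 0 := by
      rcases not_and_or.1 hIJ with h | h
      · rw [linkNorm_eq_zero hv (by omega), zero_mul]
      · rw [linkNorm_eq_zero hv (I := J) (by omega), mul_zero]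
    -- If a set has more than `r` elements its link norm vanishes, so the same bound, with a larger
    -- `m`, forces the inner sum to be zero.
    have h0 := key (max I.card J.card) (le_max_left _ _) (le_max_right _ _)
    have h1 : ∀ a : ℝ, K * ((a * linkNorm v I) * (a * linkNorm v J)) = 0 := by
      intro a
      rw [mul_mul_mul_comm, hz]
      ring
    rw [h1, abs_nonpos_iff] at h0
    rw [h0, hz]
    simp

/-- Pairs `i ∉ I` correspond to pairs `i ∈ J` with `J = I ∪ {i}`; then `N * N ^ |I| = N ^ |J|`, and
each `J` occurs `|J| ≤ r` times. The factor `N` on the left is the gain that beats `K`. -/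
theorem sum_pow_mul_linkNorm_sq_le {v : Finset V → ℝ} {N : ℝ} {r : ℕ} (hN : 0 ≤ N)
    (hv : ∀ I, r < I.card → v I = 0) :
    N * ∑ I : Finset V, 2 ^ I.card * (N ^ I.card * linkNorm v I ^ 2)
      ≤ 2 ^ r * r * ∑ I : Finset V, N ^ I.card * v I ^ 2 := by
  have h1 : ∀ I : Finset V, 2 ^ I.card * (N ^ I.card * linkNorm v I ^ 2)
      ≤ 2 ^ r * ∑ i, if i ∉ I then N ^ I.card * v (insert i I) ^ 2 else 0 := by
    intro I
    by_cases hI : I.card ≤ r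
    · have hsq : linkNorm v I ^ 2 = ∑ i, if i ∉ I then v (insert i I) ^ 2 else 0 :=
        Real.sq_sqrt (Finset.sum_nonneg fun i _ => by split_ifs <;> positivity)
      have e : N ^ I.card * linkNorm v I ^ 2
          = ∑ i, if i ∉ I then N ^ I.card * v (insert i I) ^ 2 else 0 := by
        rw [hsq, Finset.mul_sum]
        exact Finset.sum_congr rfl fun i _ => by split_ifs <;> simp
      rw [← e]
      exact mul_le_mul_of_nonneg_right (pow_le_pow_right₀ (by norm_num) hI) (by positivity)
    · rw [linkNorm_eq_zero hv (by omega)]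
      have : 0 ≤ ∑ i, if i ∉ I then N ^ I.card * v (insert i I) ^ 2 else 0 :=
        Finset.sum_nonneg fun i _ => by split_ifs <;> positivity
      simpa using this
  have h2 : ∑ I : Finset V, ∑ i, (if i ∉ I then N * (N ^ I.card * v (insert i I) ^ 2) else 0)
      = ∑ J : Finset V, ∑ j, if j ∈ J then N ^ J.card * v J ^ 2 else 0 := by
    rw [← Finset.sum_product', ← Finset.sum_product', ← Finset.sum_filter, ← Finset.sum_filter]
    refine Finset.sum_nbij' (fun q => (insert q.2 q.1, q.2)) (fun q => (q.1.erase q.2, q.2))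
      ?_ ?_ ?_ ?_ ?_
    · rintro ⟨I, i⟩ h
      simp
    · rintro ⟨I, i⟩ h
      simp
    · rintro ⟨I, i⟩ h
      simp only [Finset.mem_filter] at h
      simp [Finset.erase_insert h.2]
    · rintro ⟨I, i⟩ h
      simp only [Finset.mem_filter] at h
      simp [Finset.insert_erase h.2]
    · rintro ⟨I, i⟩ h
      simp only [Finset.mem_filter] at h
      simp only [Finset.card_insert_of_notMem h.2]
      ring
  calc _ ≤ N * ∑ I : Finset V, 2 ^ r *
        ∑ i, (if i ∉ I then N ^ I.card * v (insert i I) ^ 2 else 0) := by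
        exact mul_le_mul_of_nonneg_left (Finset.sum_le_sum fun I _ => h1 I) hN
    _ = 2 ^ r * ∑ I : Finset V,
        ∑ i, (if i ∉ I then N * (N ^ I.card * v (insert i I) ^ 2) else 0) := by
        rw [← Finset.mul_sum, mul_left_comm, Finset.mul_sum]
        simp_rw [Finset.mul_sum, mul_ite, mul_zero]
    _ = 2 ^ r * ∑ J : Finset V, J.card * (N ^ J.card * v J ^ 2) := by
        rw [h2]
        simp
    _ ≤ 2 ^ r * ∑ J : Finset V, r * (N ^ J.card * v J ^ 2) := by
        gcongr 2 ^ r * ?_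
        refine Finset.sum_le_sum fun J _ => ?_
        by_cases hJ : J.card ≤ r
        · gcongr
        · rw [hv J (by omega)]
          simp
    _ = _ := by rw [← Finset.mul_sum, mul_assoc]

/-- The binomial expansion says that `f |I ∩ J|` is the sum of `g |T|` over `T ⊆ I ∩ J`, so the
kernel splits into rank-one pieces. -/
theorem crossForm_zero (χ : V → V → ℝ) {f g : ℕ → ℝ} {v : Finset V → ℝ}
    (hfg : ∀ s, f s = ∑ j ∈ Finset.range (s + 1), s.choose j * g j) :
    crossForm χ f v 0
      = ∑ T : Finset V, g T.card * (∑ I : Finset V with T ⊆ I, v I) ^ 2 := by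
  have hf : ∀ S : Finset V, f S.card = ∑ T, if T ⊆ S then g T.card else 0 := by
    intro S
    rw [← Finset.sum_filter, hfg]
    have := Finset.sum_powerset_apply_card g (x := S)
    simp only [nsmul_eq_mul] at this
    rw [← this]
    exact Finset.sum_congr (by ext; simp) fun _ _ => rfl
  unfold crossForm
  simp_rw [zero_mul, add_zero, Finset.prod_const_one, mul_one, hf, Finset.sum_filter, sq,
    Finset.sum_mul_sum, Finset.mul_sum]
  rw [Finset.sum_congr rfl fun I _ => Finset.sum_comm, Finset.sum_comm]
  refine Finset.sum_congr rfl fun T _ => Finset.sum_congr rfl fun I _ =>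
    Finset.sum_congr rfl fun J _ => ?_
  simp only [Finset.subset_inter_iff, ite_and]
  split_ifs <;> ring

/-- The value at `0` is at least `δ W / (3 * 2 ^ r)`, and `N` times the derivative is at most `K * 3
r * 2 ^ (r ^ 2 + 3 r) * W`; `hδ` is exactly the comparison of the two. -/
theorem crossForm_one_nonneg {χ : V → V → ℝ} {f g : ℕ → ℝ} {v : Finset V → ℝ} {K N δ : ℝ}
    {r : ℕ} (hN : N = Fintype.card V) (hN1 : 1 ≤ N) (hχ0 : ∀ i, χ i i = 0)
    (hχ1 : ∀ i j, |χ i j| ≤ 1) (hK0 : 0 ≤ K) (hK : BilinBound χ K)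
    (hf0 : ∀ s ≤ r, 0 ≤ f s) (hf : ∀ s ≤ r, f s ≤ N ^ s)
    (hfg : ∀ s, f s = ∑ j ∈ Finset.range (s + 1), s.choose j * g j)
    (hg : ∀ s ≤ r, δ * N ^ s ≤ g s) (hδ : K * (9 * r * 2 ^ (r ^ 2 + 4 * r)) ≤ δ * N)
    (hv : ∀ I, r < I.card → v I = 0) : 0 ≤ crossForm χ f v 1 := by
  have hN0 : 0 < N := by linarith
  set W := ∑ I : Finset V, N ^ I.card * v I ^ 2 with hW
  have hW0 : 0 ≤ W := Finset.sum_nonneg fun I _ => by positivity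
  have hδ0 : 0 ≤ δ := by
    have : 0 ≤ δ * N := le_trans (by positivity) hδ
    exact nonneg_of_mul_nonneg_left this hN0
  have hQ : δ * W ≤ 3 * 2 ^ r * crossForm χ f v 0 := by
    rw [crossForm_zero χ hfg]
    calc δ * W ≤ δ * (3 * ∑ J : Finset V, 2 ^ J.card *
          (N ^ J.card * (∑ L : Finset V with J ⊆ L, v L) ^ 2)) := by
          gcongr
          exact sum_pow_mul_sq_le hN hN1 v
      _ = 3 * ∑ J : Finset V, 2 ^ J.card *
          (δ * N ^ J.card * (∑ L : Finset V with J ⊆ L, v L) ^ 2) := by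
          rw [mul_left_comm, Finset.mul_sum]
          congr 1
          exact Finset.sum_congr rfl fun J _ => by ring
      _ ≤ 3 * ∑ J : Finset V, 2 ^ r *
          (g J.card * (∑ L : Finset V with J ⊆ L, v L) ^ 2) := by
          gcongr 3 * ?_
          refine Finset.sum_le_sum fun J _ => ?_
          by_cases hJ : J.card ≤ r
          · have h1 := hg _ hJ
            have h2 : (0 : ℝ) ≤ g J.card := le_trans (by positivity) h1
            gcongr
            norm_num
          · rw [Finset.sum_eq_zero (s := Finset.univ.filter fun L : Finset V => J ⊆ L)]
            · simp
            · intro L hL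
              have := Finset.card_le_card (Finset.mem_filter.1 hL).2
              exact hv L (by omega)
      _ = _ := by rw [← Finset.mul_sum, mul_assoc]
  have hD : ∀ τ ∈ Set.Icc (0 : ℝ) 1,
      N * |crossFormDeriv χ f v τ| ≤ K * (3 * r * 2 ^ (r ^ 2 + 3 * r)) * W := by
    intro τ hτ
    calc N * |crossFormDeriv χ f v τ| ≤ N * (K * 2 ^ (r ^ 2 + 2 * r) *
          (3 * ∑ J : Finset V, 2 ^ J.card * (N ^ J.card * linkNorm v J ^ 2))) := by
          gcongr
          refine (abs_crossFormDeriv_le hτ hχ0 hχ1 hK0 hK hf0 hf hv).trans ?_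
          gcongr
          exact sum_sum_pow_card_inter_le hN hN1 _ (linkNorm_nonneg v)
      _ = K * 2 ^ (r ^ 2 + 2 * r) * 3 *
          (N * ∑ J : Finset V, 2 ^ J.card * (N ^ J.card * linkNorm v J ^ 2)) := by ring
      _ ≤ K * 2 ^ (r ^ 2 + 2 * r) * 3 * (2 ^ r * r * W) := by
          exact mul_le_mul_of_nonneg_left (sum_pow_mul_linkNorm_sq_le hN0.le hv) (by positivity)
      _ = _ := by ring
  obtain ⟨τ, hτ, hτ'⟩ := exists_hasDerivAt_eq_slope (crossForm χ f v) (crossFormDeriv χ f v)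
    (zero_lt_one' ℝ) (fun x _ => (hasDerivAt_crossForm χ f v x).continuousAt.continuousWithinAt)
    (fun x _ => hasDerivAt_crossForm χ f v x)
  have h1 := hD τ ⟨hτ.1.le, hτ.2.le⟩
  rw [sub_zero, div_one] at hτ'
  have h2 : N * (3 * 2 ^ r) * |crossFormDeriv χ f v τ| ≤ N * (3 * 2 ^ r * crossForm χ f v 0) := by
    calc N * (3 * 2 ^ r) * |crossFormDeriv χ f v τ|
        = 3 * 2 ^ r * (N * |crossFormDeriv χ f v τ|) := by ring
      _ ≤ 3 * 2 ^ r * (K * (3 * r * 2 ^ (r ^ 2 + 3 * r)) * W) := by gcongr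
      _ = K * (9 * r * 2 ^ (r ^ 2 + 4 * r)) * W := by ring
      _ ≤ δ * N * W := by gcongr
      _ = N * (δ * W) := by ring
      _ ≤ _ := by gcongr
  have h3 : |crossFormDeriv χ f v τ| ≤ crossForm χ f v 0 := by
    have : (0 : ℝ) < N * (3 * 2 ^ r) := by positivity
    refine le_of_mul_le_mul_left ?_ this
    linarith
  have h4 := neg_abs_le (crossFormDeriv χ f v τ)
  linarith

end CrossForm

/-! ### The clique pseudo-moments and their positivity -/

section PseudoMoments

/-- A sequence that grows fast enough is a nonnegative combination of binomial coefficients, with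
coefficients of the size of the sequence. -/
theorem exists_binomial_coeff {f : ℕ → ℝ} {r : ℕ} (hf0 : ∀ s ≤ r, 0 ≤ f s)
    (hf : ∀ s < r, 2 ^ (s + 2) * f s ≤ f (s + 1)) :
    ∃ g : ℕ → ℝ, (∀ s, f s = ∑ j ∈ Finset.range (s + 1), s.choose j * g j) ∧
      ∀ s ≤ r, f s / 2 ≤ g s := by
  -- Newton's formula: the coefficients are the iterated forward differences of `f` at `0`.
  have hfg : ∀ s, f s = ∑ j ∈ Finset.range (s + 1), s.choose j * (fwdDiff 1)^[j] f 0 := by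
    intro s
    have := shift_eq_sum_fwdDiff_iter 1 f s 0
    simpa only [zero_add, smul_eq_mul, mul_one, nsmul_eq_mul] using this
  refine ⟨fun j => (fwdDiff 1)^[j] f 0, hfg, ?_⟩
  set g : ℕ → ℝ := fun j => (fwdDiff 1)^[j] f 0
  have hmono : ∀ s ≤ r, ∀ j ≤ s, f j ≤ f s := by
    intro s hs j hj
    induction s, hj using Nat.le_induction with
    | base => exact le_rfl
    | succ s hjs ih =>
      have h1 := hf s (by omega)
      have h2 := hf0 s (by omega)
      have h3 : (1 : ℝ) ≤ 2 ^ (s + 2) := one_le_pow₀ (by norm_num)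
      have := ih (by omega)
      nlinarith
  -- The upper bound is carried along because it controls the lower-order terms at the next index,
  -- which total at most half of `f s`.
  suffices h : ∀ s ≤ r, f s / 2 ≤ g s ∧ g s ≤ f s from fun s hs => (h s hs).1
  intro s
  induction s using Nat.strong_induction_on with
  | _ s ih =>
    intro hs
    have h1 := hfg s
    rw [Finset.sum_range_succ, Nat.choose_self, Nat.cast_one, one_mul] at h1
    have h0 : 0 ≤ ∑ j ∈ Finset.range s, (s.choose j : ℝ) * g j := by
      refine Finset.sum_nonneg fun j hj => mul_nonneg (by positivity) ?_
      have hj := Finset.mem_range.1 hj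
      linarith [(ih j hj (by omega)).1, hf0 j (by omega)]
    have h2 : ∑ j ∈ Finset.range s, (s.choose j : ℝ) * g j ≤ f s / 2 := by
      rcases s with _ | s
      · simpa using div_nonneg (hf0 0 hs) zero_le_two
      · calc ∑ j ∈ Finset.range (s + 1), ((s + 1).choose j : ℝ) * g j
            ≤ ∑ j ∈ Finset.range (s + 1), ((s + 1).choose j : ℝ) * f s := by
              refine Finset.sum_le_sum fun j hj => mul_le_mul_of_nonneg_left ?_ (by positivity)
              have hj := Finset.mem_range.1 hj
              exact (ih j hj (by omega)).2.trans (hmono s (by omega) j (by omega))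
          _ ≤ 2 ^ (s + 1) * f s := by
              rw [← Finset.sum_mul]
              refine mul_le_mul_of_nonneg_right ?_ (hf0 s (by omega))
              have := Finset.sum_le_sum_of_subset (f := fun j => (s + 1).choose j)
                (Finset.range_subset_range.2 (Nat.le_succ (s + 1)))
              rw [Nat.sum_range_choose] at this
              exact_mod_cast this
          _ ≤ f (s + 1) / 2 := by
              have := hf s (by omega)
              rw [pow_succ] at this
              linarith
    change f s = ∑ j ∈ Finset.range s, (s.choose j : ℝ) * g j + g s at h1
    constructor <;> linarith

/-- The naive pseudo-moment of a clique of size `u`, for vertex density `p`. -/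
noncomputable def cliqueMoment (p : ℝ) (u : ℕ) : ℝ := p ^ u * 2 ^ u.choose 2

theorem cliqueMoment_pos {p : ℝ} (hp : 0 < p) (u : ℕ) : 0 < cliqueMoment p u := by
  unfold cliqueMoment
  positivity

theorem cliqueMoment_le_one {p : ℝ} (hp : 0 < p) {r : ℕ} (hpr : p * 4 ^ r ≤ 1) {u : ℕ}
    (hu : u ≤ 2 * r) : cliqueMoment p u ≤ 1 := by
  unfold cliqueMoment
  have h1 : u.choose 2 ≤ 2 * r * u := by
    rw [Nat.choose_two_right]
    refine (Nat.div_le_self _ _).trans ?_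
    rw [mul_comm]
    exact Nat.mul_le_mul_right _ (by omega)
  calc p ^ u * 2 ^ u.choose 2 ≤ p ^ u * 2 ^ (2 * r * u) := by
        gcongr
        norm_num
    _ = (p * 4 ^ r) ^ u := by rw [mul_pow, pow_mul, pow_mul]; norm_num
    _ ≤ 1 := pow_le_one₀ (by positivity) hpr

/-- Counting pairs inside the union against pairs inside the two sets leaves the `a * b` cross
pairs. -/
theorem cliqueMoment_mul (p : ℝ) (s a b : ℕ) :
    cliqueMoment p (s + a + b) * cliqueMoment p s
      = cliqueMoment p (s + a) * cliqueMoment p (s + b) * 2 ^ (a * b) := by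
  unfold cliqueMoment
  have h : (s + a + b).choose 2 + s.choose 2 = (s + a).choose 2 + (s + b).choose 2 + a * b := by
    have : (((s + a + b).choose 2 + s.choose 2 : ℕ) : ℚ)
        = ((s + a).choose 2 + (s + b).choose 2 + a * b : ℕ) := by
      push_cast [Nat.cast_choose_two]
      ring
    exact_mod_cast this
  calc _ = p ^ (s + a + b + s) * 2 ^ ((s + a + b).choose 2 + s.choose 2) := by
        rw [pow_add p, pow_add 2]; ring
    _ = _ := by
        rw [h, pow_add 2, pow_add 2, show s + a + b + s = (s + a) + (s + b) by ring, pow_add p]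
        ring

variable {V : Type*} [DecidableEq V]

open scoped Classical in
/-- The `±1` adjacency matrix, with zero diagonal. -/
noncomputable def edgeSign (G : SimpleGraph V) (i j : V) : ℝ :=
  if i = j then 0 else if G.Adj i j then 1 else -1

theorem edgeSign_self (G : SimpleGraph V) (i : V) : edgeSign G i i = 0 := by simp [edgeSign]

theorem edgeSign_comm (G : SimpleGraph V) (i j : V) : edgeSign G i j = edgeSign G j i := by
  unfold edgeSign
  by_cases hij : i = j
  · rw [if_pos hij, if_pos hij.symm]
  · rw [if_neg hij, if_neg (Ne.symm hij)]
    by_cases h : G.Adj i j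
    · rw [if_pos h, if_pos h.symm]
    · rw [if_neg h, if_neg (fun h' => h h'.symm)]

theorem abs_edgeSign_le (G : SimpleGraph V) (i j : V) : |edgeSign G i j| ≤ 1 := by
  unfold edgeSign
  split_ifs <;> simp

open scoped Classical in
theorem prod_one_add_edgeSign (G : SimpleGraph V) {A B : Finset V} (h : Disjoint A B) :
    ∏ e ∈ A ×ˢ B, (1 + 1 * edgeSign G e.1 e.2)
      = if ∀ a ∈ A, ∀ b ∈ B, G.Adj a b then 2 ^ (A.card * B.card) else 0 := by
  split_ifs with hAB
  · rw [Finset.prod_eq_pow_card (b := 2), Finset.card_product]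
    rintro ⟨a, b⟩ hab
    have hab := Finset.mem_product.1 hab
    have hadj := hAB a hab.1 b hab.2
    simp only [edgeSign, if_neg hadj.ne, if_pos hadj]
    norm_num
  · push Not at hAB
    obtain ⟨a, ha, b, hb, hab⟩ := hAB
    refine Finset.prod_eq_zero (i := (a, b)) (Finset.mem_product.2 ⟨ha, hb⟩) ?_
    have : a ≠ b := fun e => Finset.disjoint_left.1 h ha (e ▸ hb)
    simp only [edgeSign, if_neg this, if_neg hab]
    norm_num

open scoped Classical in
/-- The moment of the set `S`, which vanishes unless `S` is a clique. -/
noncomputable def pseudoMoment (G : SimpleGraph V) (p : ℝ) (S : Finset V) : ℝ :=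
  if G.IsClique (S : Set V) then cliqueMoment p S.card else 0

theorem isClique_union_iff (G : SimpleGraph V) (I J : Finset V) :
    G.IsClique ((I ∪ J : Finset V) : Set V) ↔ G.IsClique (I : Set V) ∧ G.IsClique (J : Set V) ∧
      ∀ a ∈ I \ J, ∀ b ∈ J \ I, G.Adj a b := by
  constructor
  · intro h
    refine ⟨h.subset (by simp), h.subset (by simp), fun a ha b hb => ?_⟩
    simp only [Finset.mem_sdiff] at ha hb
    exact h (by simp [ha.1]) (by simp [hb.1]) (by rintro rfl; exact ha.2 hb.1)
  · rintro ⟨hI, hJ, h⟩ a ha b hb hab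
    simp only [Finset.coe_union, Set.mem_union, Finset.mem_coe, Finset.mem_sdiff] at ha hb h
    by_cases haI : a ∈ I
    · by_cases hbI : b ∈ I
      · exact hI haI hbI hab
      · by_cases haJ : a ∈ J
        · exact hJ haJ (by tauto) hab
        · exact h a ⟨haI, haJ⟩ b ⟨by tauto, hbI⟩
    · by_cases hbJ : b ∈ J
      · exact hJ (by tauto) hbJ hab
      · exact (h b ⟨by tauto, hbJ⟩ a ⟨by tauto, haI⟩).symm

/-- For two cliques, the product over cross pairs is `2 ^ (number of pairs)` if all are edges and
`0` otherwise, which is both the missing power of two and the indicator that the union is a clique.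
-/
theorem pseudoMoment_union (G : SimpleGraph V) {p : ℝ} (hp : 0 < p) (I J : Finset V) :
    pseudoMoment G p (I ∪ J) = pseudoMoment G p I * pseudoMoment G p J *
      (cliqueMoment p (I ∩ J).card)⁻¹ *
      ∏ e ∈ (I \ J) ×ˢ (J \ I), (1 + 1 * edgeSign G e.1 e.2) := by
  classical
  rw [prod_one_add_edgeSign G (Finset.disjoint_left.2 (by grind))]
  unfold pseudoMoment
  by_cases hI : G.IsClique (I : Set V)
  · by_cases hJ : G.IsClique (J : Set V)
    · by_cases h : ∀ a ∈ I \ J, ∀ b ∈ J \ I, G.Adj a b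
      · rw [if_pos ((isClique_union_iff G I J).2 ⟨hI, hJ, h⟩), if_pos hI, if_pos hJ, if_pos h]
        have hs := cliqueMoment_pos hp (I ∩ J).card
        have e1 := Finset.card_sdiff_add_card_inter I J
        have e2 := Finset.card_sdiff_add_card_inter J I
        rw [Finset.inter_comm J I] at e2
        have e3 := Finset.card_union_add_card_inter I J
        have key := cliqueMoment_mul p (I ∩ J).card (I \ J).card (J \ I).card
        rw [show (I ∩ J).card + (I \ J).card + (J \ I).card = (I ∪ J).card by omega,
          show (I ∩ J).card + (I \ J).card = I.card by omega,
          show (I ∩ J).card + (J \ I).card = J.card by omega] at key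
        rw [eq_comm, mul_right_comm, ← key]
        field_simp
      · rw [if_neg (fun hc => h ((isClique_union_iff G I J).1 hc).2.2), if_neg h, mul_zero]
    · rw [if_neg (fun hc => hJ ((isClique_union_iff G I J).1 hc).2.1), if_neg hJ]
      simp
  · rw [if_neg (fun hc => hI ((isClique_union_iff G I J).1 hc).1), if_neg hI]
    simp

theorem pseudoMoment_mem_Icc (G : SimpleGraph V) {p : ℝ} (hp : 0 < p) {r : ℕ}
    (hpr : p * 4 ^ r ≤ 1) {S : Finset V} (hS : S.card ≤ 2 * r) :
    pseudoMoment G p S ∈ Set.Icc (0 : ℝ) 1 := by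
  unfold pseudoMoment
  split_ifs
  · exact ⟨(cliqueMoment_pos hp _).le, cliqueMoment_le_one hp hpr hS⟩
  · simp

variable [Fintype V]

theorem pseudoMoment_form_nonneg {G : SimpleGraph V} {r : ℕ} {k K : ℝ} (hk : 1 ≤ k)
    (hkr : k * 4 ^ r ≤ Fintype.card V) (hK0 : 0 ≤ K) (hK : BilinBound (edgeSign G) K)
    (hkK : K * (18 * r * 2 ^ (2 * r ^ 2 + 4 * r)) * k ^ r ≤ Fintype.card V)
    (x : Finset V → ℝ) (hx : ∀ I, r < I.card → x I = 0) :
    0 ≤ ∑ I, ∑ J, x I * x J * pseudoMoment G (k / Fintype.card V) (I ∪ J) := by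
  set N : ℝ := (Fintype.card V : ℝ) with hN
  set p := k / N with hp
  have h4 : (1 : ℝ) ≤ 4 ^ r := one_le_pow₀ (by norm_num)
  have hN1 : 1 ≤ N := by nlinarith
  have hp0 : 0 < p := by positivity
  have hpr : p * 4 ^ r ≤ 1 := by
    rw [hp, div_mul_eq_mul_div, div_le_one (by positivity)]
    exact hkr
  -- The ratio of consecutive values of `f` is `1 / (p * 2 ^ s)`, which is at least `2 ^ (s + 2)`
  -- because `p * 4 ^ r ≤ 1`.
  obtain ⟨g, hfg, hg⟩ := exists_binomial_coeff (f := fun s => (cliqueMoment p s)⁻¹) (r := r)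
    (fun s _ => (inv_pos.2 (cliqueMoment_pos hp0 s)).le) (by
      intro s hs
      have e : cliqueMoment p (s + 1) = cliqueMoment p s * (p * 2 ^ s) := by
        unfold cliqueMoment
        rw [Nat.choose_succ_succ' s 1, Nat.choose_one_right, pow_add 2]
        ring
      rw [e, mul_inv, mul_comm]
      refine mul_le_mul_of_nonneg_left ?_ (inv_pos.2 (cliqueMoment_pos hp0 s)).le
      rw [le_inv_comm₀ (by positivity) (by positivity), ← one_div, le_div_iff₀ (by positivity)]
      calc p * 2 ^ s * 2 ^ (s + 2) = p * 4 ^ (s + 1) := by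
            rw [show (4 : ℝ) = 2 ^ 2 by norm_num, ← pow_mul]; ring
        _ ≤ p * 4 ^ r := by
            gcongr
            · norm_num
            · omega
        _ ≤ 1 := hpr)
  have hform : ∑ I, ∑ J, x I * x J * pseudoMoment G p (I ∪ J)
      = crossForm (edgeSign G) (fun s => (cliqueMoment p s)⁻¹)
        (fun I => x I * pseudoMoment G p I) 1 := by
    unfold crossForm
    refine Finset.sum_congr rfl fun I _ => Finset.sum_congr rfl fun J _ => ?_
    rw [pseudoMoment_union G hp0]
    ring
  rw [hform]
  -- Since `1 / p = N / k`, the value `f s` lies between `N ^ s / (k ^ r * 2 ^ r ^ 2)` and `N ^ s`;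
  -- the extra half in `δ` is the loss from `f` to `g`.
  refine crossForm_one_nonneg (g := g) (N := N) (K := K) (δ := (k ^ r * 2 ^ r ^ 2)⁻¹ / 2) (r := r)
    hN hN1 (edgeSign_self G) (abs_edgeSign_le G) hK0 hK
    (fun s _ => (inv_pos.2 (cliqueMoment_pos hp0 s)).le) ?_ hfg ?_ ?_ ?_
  · intro s _
    unfold cliqueMoment
    rw [inv_le_comm₀ (by positivity) (by positivity), ← inv_pow]
    calc N⁻¹ ^ s ≤ p ^ s := by
          gcongr
          rw [hp, ← one_div]
          gcongr
      _ ≤ p ^ s * 2 ^ s.choose 2 := le_mul_of_one_le_right (by positivity)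
          (one_le_pow₀ (by norm_num))
  · intro s hs
    refine le_trans ?_ (hg s hs)
    rw [div_mul_eq_mul_div]
    gcongr
    have h1 : s.choose 2 ≤ r ^ 2 := by
      rw [Nat.choose_two_right, sq]
      exact (Nat.div_le_self _ _).trans (Nat.mul_le_mul hs (by omega))
    rw [cliqueMoment, hp, div_pow, inv_mul_le_iff₀ (by positivity)]
    calc N ^ s = (k ^ s * 2 ^ s.choose 2) * (k ^ s / N ^ s * 2 ^ s.choose 2)⁻¹ := by
          field_simp
      _ ≤ (k ^ r * 2 ^ r ^ 2) * (k ^ s / N ^ s * 2 ^ s.choose 2)⁻¹ := by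
          gcongr
          norm_num
  · have e : (k ^ r * 2 ^ r ^ 2)⁻¹ / 2 * N = N / (k ^ r * 2 ^ r ^ 2 * 2) := by
      field_simp
    rw [e, le_div_iff₀ (by positivity)]
    calc _ = K * (18 * r * 2 ^ (2 * r ^ 2 + 4 * r)) * k ^ r := by
          rw [show 2 * r ^ 2 + 4 * r = (r ^ 2 + 4 * r) + r ^ 2 by ring, pow_add 2 _ (r ^ 2)]
          ring
      _ ≤ N := hkK
  · intro I hI
    simp only [hx I hI, zero_mul]

theorem exists_isSOSCliqueSolution {G : SimpleGraph V} {r : ℕ} (hr : 1 ≤ r) {k K : ℝ}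
    (hk : 1 ≤ k) (hkr : k * 4 ^ r ≤ Fintype.card V) (hK0 : 0 ≤ K)
    (hK : BilinBound (edgeSign G) K)
    (hkK : K * (18 * r * 2 ^ (2 * r ^ 2 + 4 * r)) * k ^ r ≤ Fintype.card V) (d : ℕ) :
    k ∈ sosCliqueObjectives G r d := by
  classical
  set N : ℝ := (Fintype.card V : ℝ) with hN
  set p := k / N with hp
  have h4 : (1 : ℝ) ≤ 4 ^ r := one_le_pow₀ (by norm_num)
  have hN1 : 1 ≤ N := by nlinarith
  have hp0 : 0 < p := by positivity
  have hpr : p * 4 ^ r ≤ 1 := by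
    rw [hp, div_mul_eq_mul_div, div_le_one (by positivity)]
    exact hkr
  -- Truncation to sets of size at most `r` gives a positive semidefinite matrix on all finite sets,
  -- whose Gram vectors are the solution.
  let t : Finset V → ℝ := fun I => if I.card ≤ r then 1 else 0
  let M : Matrix (Finset V) (Finset V) ℝ :=
    Matrix.of fun I J => t I * t J * pseudoMoment G p (I ∪ J)
  have hM : M.PosSemidef := by
    refine .of_dotProduct_mulVec_nonneg ?_ fun x => ?_
    · ext I J
      simp only [M, Matrix.conjTranspose_apply, Matrix.of_apply, star_trivial, Finset.union_comm]
      ring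
    · have h := pseudoMoment_form_nonneg hk hkr hK0 hK hkK (fun I => t I * x I)
        fun I hI => by simp only [t, if_neg (not_le.2 hI), zero_mul]
      refine h.trans_eq ?_
      simp only [dotProduct, Matrix.mulVec, star_trivial, M, Matrix.of_apply, Finset.mul_sum]
      exact Finset.sum_congr rfl fun I _ => Finset.sum_congr rfl fun J _ => by ring
  obtain ⟨m, w, hw⟩ := Matrix.posSemidef_iff_eq_sum_vecMulVec.1 hM
  let U : Finset V → EuclideanSpace ℝ (Fin m) := fun S => WithLp.toLp 2 fun i => w i S
  have hU : ∀ I J, inner ℝ (U I) (U J) = t I * t J * pseudoMoment G p (I ∪ J) := by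
    intro I J
    have := congrFun (congrFun hw I) J
    simp only [M, Matrix.of_apply, Matrix.sum_apply, Matrix.vecMulVec_apply,
      star_trivial] at this
    rw [this, EuclideanSpace.inner_eq_star_dotProduct]
    simp only [U, dotProduct, star_trivial]
    exact Finset.sum_congr rfl fun i _ => mul_comm _ _
  have hU' : ∀ I J : Finset V, I.card ≤ r → J.card ≤ r →
      inner ℝ (U I) (U J) = pseudoMoment G p (I ∪ J) := by
    intro I J hI hJ
    simp only [hU, t, if_pos hI, if_pos hJ, one_mul]
  refine ⟨m, U, ⟨?_, ?_, ?_, ?_⟩, ?_⟩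
  · intro i j hij hadj
    rw [hU' _ _ (by simpa using hr) (by simpa using hr), pseudoMoment, if_neg]
    intro hc
    exact hadj (hc (by simp) (by simp) hij)
  · intro S₁ S₂ S₃ S₄ h₁ h₂ h₃ h₄ hS _
    rw [hU' _ _ h₁ h₂, hU' _ _ h₃ h₄, hS]
  · intro S₁ S₂ h₁ h₂
    rw [hU' _ _ h₁ h₂]
    exact pseudoMoment_mem_Icc G hp0 hpr ((Finset.card_union_le _ _).trans (by omega))
  · rw [← real_inner_self_eq_norm_sq, hU' _ _ (by simp) (by simp)]
    simp [pseudoMoment, cliqueMoment]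
  · have : ∀ i : V, ‖U {i}‖ ^ 2 = p := by
      intro i
      rw [← real_inner_self_eq_norm_sq, hU' _ _ (by simpa using hr) (by simpa using hr)]
      simp [pseudoMoment, cliqueMoment]
    simp only [this, Finset.sum_const, Finset.card_univ, nsmul_eq_mul, ← hN]
    rw [hp]
    field_simp

end PseudoMoments

/-! ### Monotonicity and the trivial lower bound on the gap -/

section Gap

variable {V : Type*} [Fintype V] [DecidableEq V]

theorem sosCliqueObjectives_mono {G H : SimpleGraph V} (h : G ≤ H) (r d : ℕ) :
    sosCliqueObjectives G r d ⊆ sosCliqueObjectives H r d := by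
  rintro v ⟨m, U, hU, rfl⟩
  exact ⟨m, U, ⟨fun i j hij hadj => hU.edge i j hij fun hG => hadj (h hG),
    hU.consistent, hU.mem_Icc, hU.unit⟩, rfl⟩

/-- The one-dimensional integral solution: the indicator of being contained in `s`. -/
theorem card_clique_mem_sosCliqueObjectives {G : SimpleGraph V} {s : Finset V}
    (hs : G.IsClique (s : Set V)) (r d : ℕ) : (s.card : ℝ) ∈ sosCliqueObjectives G r d := by
  have h : ∀ A B : Finset V,
      inner ℝ (if A ⊆ s then EuclideanSpace.single (0 : Fin 1) (1 : ℝ) else 0)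
        (if B ⊆ s then EuclideanSpace.single (0 : Fin 1) (1 : ℝ) else 0)
        = if A ∪ B ⊆ s then (1 : ℝ) else 0 := by
    intro A B
    by_cases hA : A ⊆ s <;> by_cases hB : B ⊆ s <;> simp [hA, hB, Finset.union_subset_iff]
  refine ⟨1, fun S => if S ⊆ s then EuclideanSpace.single 0 1 else 0, ⟨?_, ?_, ?_, ?_⟩, ?_⟩
  · intro i j hij hadj
    rw [h, if_neg]
    intro hc
    exact hadj (hs (hc (by simp)) (hc (by simp)) hij)
  · intro S₁ S₂ S₃ S₄ _ _ _ _ hS _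
    rw [h, h, hS]
  · intro S₁ S₂ _ _
    rw [h]
    split_ifs <;> simp
  · simp
  · have : ∀ i : V, ‖(if ({i} : Finset V) ⊆ s then
        EuclideanSpace.single (0 : Fin 1) (1 : ℝ) else 0)‖ ^ 2 = if i ∈ s then 1 else 0 := by
      intro i
      simp only [Finset.singleton_subset_iff]
      split_ifs <;> simp
    simp only [this]
    simp

theorem one_le_cliqueNum {V : Type*} [Fintype V] [Nonempty V] (G : SimpleGraph V) : 1 ≤ G.cliqueNum := by
  have : G.IsClique (({Classical.arbitrary V} : Finset V) : Set V) := by simp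
  simpa using this.card_le_cliqueNum

theorem one_le_sosCliqueGap [Nonempty V] (G : SimpleGraph V) {r : ℕ} (hr : 1 ≤ r) (d : ℕ) :
    1 ≤ sosCliqueGap G r d := by
  obtain ⟨s, hs⟩ := G.exists_isNClique_cliqueNum
  have h1 : (0 : ℝ) < G.cliqueNum := by exact_mod_cast one_le_cliqueNum G
  rw [sosCliqueGap, le_div_iff₀ h1, one_mul, ← hs.card_eq]
  exact le_csSup (sosCliqueObjectives_bddAbove G hr d)
    (card_clique_mem_sosCliqueObjectives hs.isClique r d)

/-- Outside `S`, a clique of the enlarged graph is already a clique of `G`. -/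
theorem cliqueNum_sup_cliqueOn_le (G : SimpleGraph V) (S : Finset V) :
    (G ⊔ cliqueOn S).cliqueNum ≤ G.cliqueNum + S.card := by
  obtain ⟨s, hs⟩ := (G ⊔ cliqueOn S).exists_isNClique_cliqueNum
  have h1 : G.IsClique ((s \ S : Finset V) : Set V) := by
    intro a ha b hb hab
    simp only [Finset.coe_sdiff, Set.mem_sdiff, Finset.mem_coe] at ha hb
    rcases hs.isClique ha.1 hb.1 hab with h | h
    · exact h
    · exact absurd h.2.1 ha.2
  have h2 := h1.card_le_cliqueNum
  have h3 := Finset.card_sdiff_add_card_inter s S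
  have h4 := Finset.card_le_card (Finset.inter_subset_right (s₁ := s) (s₂ := S))
  rw [← hs.card_eq]
  omega

end Gap

/-! ### Operator norm and clique number of `G(n, 1/2)` -/

section RandomGraph

instance (n : ℕ) : MeasurableSingletonClass (SimpleGraph (Fin n)) := ⟨fun G => by
  have h : (SimpleGraph.edgeSet ⁻¹' {G.edgeSet} : Set (SimpleGraph (Fin n))) = {G} := by
    ext H
    simp
  rw [← h]
  exact SimpleGraph.measurableEmbedding_edgeSet.measurable (measurableSet_singleton _)⟩

instance (n : ℕ) : IsProbabilityMeasure (randomGraph n) := by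
  unfold randomGraph
  infer_instance

theorem randomGraph_real_singleton {n : ℕ} (G : SimpleGraph (Fin n)) :
    (randomGraph n).real {G} = (1 / 2) ^ (n.choose 2) := by
  classical
  have hle : G.edgeSet.ncard ≤ n.choose 2 := by
    have := G.card_edgeFinset_le_card_choose_two
    rw [Fintype.card_fin] at this
    rwa [← SimpleGraph.coe_edgeFinset, Set.ncard_coe_finset]
  rw [randomGraph, measureReal_def, SimpleGraph.binomialRandom_singleton, Nat.card_eq_fintype_card,
    Fintype.card_fin]
  have hσ : unitInterval.symm (⟨1 / 2, by norm_num, by norm_num⟩ : unitInterval)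
      = ⟨1 / 2, by norm_num, by norm_num⟩ := by
    ext
    norm_num [unitInterval.coe_symm_eq]
  rw [hσ, ← pow_add, Nat.add_sub_cancel' hle, ENNReal.toReal_pow]
  rfl

/-- The pairs of vertices, each listed once. -/
def vertexPairs (n : ℕ) : Finset (Fin n × Fin n) := Finset.univ.filter fun e => e.1 < e.2

-- Graphs correspond to subsets of the vertex pairs, which index the terms of the expanded product.
open scoped Classical in
theorem sum_graph_exp {n : ℕ} (c : Fin n × Fin n → ℝ) :
    ∑ G : SimpleGraph (Fin n), Real.exp (∑ e ∈ vertexPairs n, c e * edgeSign G e.1 e.2)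
      = ∏ e ∈ vertexPairs n, (Real.exp (c e) + Real.exp (-c e)) := by
  rw [Finset.prod_add]
  refine Finset.sum_nbij' (fun G => (vertexPairs n).filter fun e => G.Adj e.1 e.2)
    (fun t => SimpleGraph.fromRel fun i j => (i, j) ∈ t) ?_ ?_ ?_ ?_ ?_
  · intro G _
    simp
  · intro t _
    simp
  · intro G _
    ext i j
    simp only [SimpleGraph.fromRel_adj, Finset.mem_filter, vertexPairs, Finset.mem_univ, true_and]
    constructor
    · rintro ⟨_, h | h⟩
      · exact h.2
      · exact h.2.symm
    · intro h
      refine ⟨h.ne, ?_⟩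
      rcases lt_or_gt_of_ne h.ne with hlt | hlt
      · exact Or.inl ⟨hlt, h⟩
      · exact Or.inr ⟨hlt, h.symm⟩
  · intro t ht
    rw [Finset.mem_powerset] at ht
    ext ⟨i, j⟩
    simp only [SimpleGraph.fromRel_adj, Finset.mem_filter, vertexPairs, Finset.mem_univ, true_and]
    constructor
    · rintro ⟨hij, _, h | h⟩
      · exact h
      · have := ht h
        simp only [vertexPairs, Finset.mem_filter] at this
        exact absurd this.2 hij.asymm
    · intro h
      have h' := ht h
      simp only [vertexPairs, Finset.mem_filter] at h'
      exact ⟨h'.2, h'.2.ne, Or.inl h⟩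
  · intro G _
    rw [Real.exp_sum, ← Finset.prod_sdiff (Finset.filter_subset (fun e => G.Adj e.1 e.2)
      (vertexPairs n)), mul_comm]
    congr 1
    · refine Finset.prod_congr rfl fun e he => ?_
      have he := (Finset.mem_filter.1 he).2
      simp [edgeSign, he, he.ne]
    · refine Finset.prod_congr rfl fun e he => ?_
      simp only [vertexPairs, Finset.mem_sdiff, Finset.mem_filter, Finset.mem_univ, true_and] at he
      have h2 : ¬ G.Adj e.1 e.2 := fun h => he.2 ⟨he.1, h⟩
      simp [edgeSign, h2, he.1.ne]

/-- Chernoff bound for linear forms in the edge signs of `G(n, 1/2)`. -/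
theorem randomGraph_chernoff {n : ℕ} (c : Fin n × Fin n → ℝ) (a : ℝ) :
    (randomGraph n).real {G | a ≤ ∑ e ∈ vertexPairs n, c e * edgeSign G e.1 e.2}
      ≤ Real.exp ((∑ e ∈ vertexPairs n, c e ^ 2) / 2 - a) := by
  classical
  set q : ℝ := (1 / 2) ^ (n.choose 2) with hq
  have hq0 : 0 < q := by positivity
  -- Total mass one, read off from the generating function at `c = 0`.
  have hone : q * 2 ^ (vertexPairs n).card = 1 := by
    have h1 := sum_graph_exp (n := n) (fun _ => 0)
    simp only [zero_mul, Finset.sum_const_zero, Real.exp_zero, neg_zero, Finset.prod_const] at h1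
    have h2 := sum_measureReal_singleton (μ := randomGraph n) Finset.univ
    simp only [randomGraph_real_singleton, ← hq, Finset.coe_univ, probReal_univ] at h2
    rw [← one_add_one_eq_two, ← h1, Finset.mul_sum]
    simpa using h2
  have hmeas : ∀ s : Set (SimpleGraph (Fin n)), (randomGraph n).real s
      = ∑ G ∈ Finset.univ.filter (· ∈ s), q := by
    intro s
    have h2 := sum_measureReal_singleton (μ := randomGraph n) (Finset.univ.filter (· ∈ s))
    simp only [randomGraph_real_singleton, ← hq] at h2
    rw [h2]
    congr 1
    ext G
    simp
  rw [hmeas]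
  calc _ ≤ ∑ G ∈ Finset.univ.filter
          (· ∈ {G : SimpleGraph (Fin n) | a ≤ ∑ e ∈ vertexPairs n, c e * edgeSign G e.1 e.2}),
          q * Real.exp (∑ e ∈ vertexPairs n, c e * edgeSign G e.1 e.2 - a) := by
        refine Finset.sum_le_sum fun G hG => le_mul_of_one_le_right hq0.le ?_
        simp only [Finset.mem_filter, Set.mem_ofPred_eq] at hG
        rw [Real.one_le_exp_iff]
        linarith [hG.2]
    _ ≤ ∑ G : SimpleGraph (Fin n),
          q * Real.exp (∑ e ∈ vertexPairs n, c e * edgeSign G e.1 e.2 - a) :=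
        Finset.sum_le_sum_of_subset_of_nonneg (Finset.filter_subset _ _)
          fun _ _ _ => by positivity
    _ = (q * ∏ e ∈ vertexPairs n, (Real.exp (c e) + Real.exp (-c e))) * Real.exp (-a) := by
        rw [← sum_graph_exp, Finset.mul_sum, Finset.sum_mul]
        refine Finset.sum_congr rfl fun G _ => ?_
        rw [sub_eq_add_neg, Real.exp_add, mul_assoc]
    _ = (∏ e ∈ vertexPairs n, Real.cosh (c e)) * Real.exp (-a) := by
        have : ∏ e ∈ vertexPairs n, (Real.exp (c e) + Real.exp (-c e))
            = 2 ^ (vertexPairs n).card * ∏ e ∈ vertexPairs n, Real.cosh (c e) := by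
          rw [← Finset.prod_const, ← Finset.prod_mul_distrib]
          refine Finset.prod_congr rfl fun e _ => ?_
          rw [Real.cosh_eq]
          ring
        rw [this, ← mul_assoc, hone, one_mul]
    _ ≤ (∏ e ∈ vertexPairs n, Real.exp (c e ^ 2 / 2)) * Real.exp (-a) := by
        refine mul_le_mul_of_nonneg_right (Finset.prod_le_prod (fun e _ => ?_) fun e _ => ?_)
          (Real.exp_pos _).le
        · exact (Real.cosh_pos _).le
        · exact Real.cosh_le_exp_half_sq _
    _ = _ := by
        rw [← Real.exp_sum, ← Real.exp_add, ← Finset.sum_div, sub_eq_add_neg]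

theorem sum_edgeSign_eq {n : ℕ} (G : SimpleGraph (Fin n)) (x y : Fin n → ℝ) :
    ∑ i, ∑ j, edgeSign G i j * (x i * y j)
      = ∑ e ∈ vertexPairs n, (x e.1 * y e.2 + x e.2 * y e.1) * edgeSign G e.1 e.2 := by
  have h1 : ∀ F : Fin n × Fin n → ℝ, (∀ i, F (i, i) = 0) →
      ∑ e, F e = ∑ e ∈ vertexPairs n, (F e + F (e.2, e.1)) := by
    intro F hF
    have h2 : ∑ e ∈ vertexPairs n, F (e.2, e.1)
        = ∑ e ∈ (Finset.univ.filter fun e : Fin n × Fin n => ¬ e.1 < e.2), F e := by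
      rw [← Finset.sum_filter_add_sum_filter_not
        (Finset.univ.filter fun e : Fin n × Fin n => ¬ e.1 < e.2) (fun e => e.2 < e.1),
        Finset.sum_eq_zero
          (s := Finset.filter (fun e : Fin n × Fin n => ¬ e.2 < e.1) _), add_zero]
      · refine Finset.sum_nbij' Prod.swap Prod.swap ?_ ?_ ?_ ?_ ?_
        · rintro ⟨i, j⟩ h
          simp only [vertexPairs, Finset.mem_filter, Finset.mem_univ, true_and,
            Prod.swap] at h ⊢
          exact ⟨h.asymm, h⟩
        · rintro ⟨i, j⟩ h
          simp only [vertexPairs, Finset.mem_filter, Finset.mem_univ, true_and,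
            Prod.swap] at h ⊢
          exact h.2
        · simp
        · simp
        · rintro ⟨i, j⟩ _
          rfl
      · rintro ⟨i, j⟩ h
        simp only [Finset.mem_filter, Finset.mem_univ, true_and, not_lt] at h
        obtain rfl : i = j := le_antisymm h.2 h.1
        exact hF i
    rw [Finset.sum_add_distrib, h2, vertexPairs, Finset.sum_filter_add_sum_filter_not]
  rw [← Fintype.sum_prod_type' (f := fun i j => edgeSign G i j * (x i * y j)),
    h1 _ (fun i => by simp [edgeSign_self])]
  refine Finset.sum_congr rfl fun e _ => ?_
  rw [edgeSign_comm G e.2 e.1]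
  ring

theorem sum_vertexPairs_sq_le {n : ℕ} (x y : Fin n → ℝ) :
    ∑ e ∈ vertexPairs n, (x e.1 * y e.2 + x e.2 * y e.1) ^ 2
      ≤ 4 * ((∑ i, x i ^ 2) * ∑ j, y j ^ 2) := by
  calc _ ≤ ∑ e ∈ vertexPairs n, (2 * ((x e.1 * y e.2) ^ 2 + (x e.2 * y e.1) ^ 2)) := by
        refine Finset.sum_le_sum fun e _ => ?_
        nlinarith [sq_nonneg (x e.1 * y e.2 - x e.2 * y e.1)]
    _ ≤ ∑ e : Fin n × Fin n, (2 * ((x e.1 * y e.2) ^ 2 + (x e.2 * y e.1) ^ 2)) :=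
        Finset.sum_le_sum_of_subset_of_nonneg (Finset.subset_univ _) fun _ _ _ => by positivity
    _ = 4 * ((∑ i, x i ^ 2) * ∑ j, y j ^ 2) := by
        rw [← Finset.mul_sum, Finset.sum_add_distrib, Fintype.sum_prod_type, Fintype.sum_prod_type,
          Finset.sum_comm (f := fun i j => (x (i, j).2 * y (i, j).1) ^ 2), Finset.sum_mul_sum]
        simp only [mul_pow]
        ring

/-- A finite set of at most `5 ^ n` points of the ball of radius `2`, at distance less than `1`
from every point of the ball. -/
theorem exists_net (n : ℕ) : ∃ T : Finset (EuclideanSpace ℝ (Fin n)), T.card ≤ 5 ^ n ∧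
    (∀ c ∈ T, ‖c‖ ≤ 2) ∧ ∀ x : EuclideanSpace ℝ (Fin n), ‖x‖ ≤ 2 → ∃ c ∈ T, ‖x - c‖ ≤ 1 := by
  classical
  let P : Finset (EuclideanSpace ℝ (Fin n)) → Prop := fun s =>
    (∀ c ∈ s, ‖c‖ ≤ 2) ∧ ∀ c ∈ s, ∀ d ∈ s, c ≠ d → 1 ≤ ‖c - d‖
  have hcard : ∀ s, P s → s.card ≤ 5 ^ n := by
    intro s hs
    simpa using Besicovitch.card_le_of_separated s hs.1 hs.2
  let Q : ℕ → Prop := fun m => ∃ s, P s ∧ s.card = m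
  have hQ : Q (Nat.findGreatest Q (5 ^ n)) :=
    Nat.findGreatest_spec (P := Q) (Nat.zero_le _) ⟨∅, ⟨by simp, by simp⟩, by simp⟩
  obtain ⟨T, hT, hTm⟩ := hQ
  refine ⟨T, hcard T hT, hT.1, fun x hx => ?_⟩
  by_contra! hfar
  have hxT : x ∉ T := fun h => by
    have := hfar x h
    simp at this
    linarith
  have hP : P (insert x T) := by
    refine ⟨fun c hc => ?_, fun c hc d hd hcd => ?_⟩
    · rcases Finset.mem_insert.1 hc with rfl | hc
      · exact hx
      · exact hT.1 c hc
    · rcases Finset.mem_insert.1 hc with rfl | hc'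
      · rcases Finset.mem_insert.1 hd with rfl | hd'
        · exact absurd rfl hcd
        · exact (hfar d hd').le
      · rcases Finset.mem_insert.1 hd with rfl | hd'
        · rw [norm_sub_rev]
          exact (hfar c hc').le
        · exact hT.2 c hc' d hd' hcd
  have := Nat.le_findGreatest (P := Q) (hcard _ hP) ⟨_, hP, rfl⟩
  rw [Finset.card_insert_of_notMem hxT, hTm] at this
  omega

/-- A linear map is bounded by its values on a `1`-net of the ball of radius `2`. -/
theorem opNorm_le_of_net {n : ℕ} {F : Type*} [NormedAddCommGroup F] [NormedSpace ℝ F]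
    {T : Finset (EuclideanSpace ℝ (Fin n))}
    (hT : ∀ x : EuclideanSpace ℝ (Fin n), ‖x‖ ≤ 2 → ∃ c ∈ T, ‖x - c‖ ≤ 1)
    (φ : EuclideanSpace ℝ (Fin n) →L[ℝ] F) {C : ℝ} (hφ : ∀ c ∈ T, ‖φ c‖ ≤ C) : ‖φ‖ ≤ C := by
  have hC : 0 ≤ C := by
    obtain ⟨c, hc, _⟩ := hT 0 (by simp)
    exact (norm_nonneg _).trans (hφ c hc)
  -- For a unit vector `x`, approximating `2 x` within `1` gives `2 ‖φ x‖ ≤ C + ‖φ‖`; the radius `2`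
  -- is what lets this close up.
  have h1 : ‖φ‖ ≤ (C + ‖φ‖) / 2 := by
    refine φ.opNorm_le_of_unit_norm (by positivity) fun x hx => ?_
    obtain ⟨c, hc, hxc⟩ := hT ((2 : ℝ) • x) (by rw [norm_smul, hx]; norm_num)
    have h2 : ‖φ ((2 : ℝ) • x)‖ ≤ C + ‖φ‖ := by
      calc ‖φ ((2 : ℝ) • x)‖ = ‖φ c + φ ((2 : ℝ) • x - c)‖ := by rw [← map_add]; simp
        _ ≤ ‖φ c‖ + ‖φ‖ * ‖(2 : ℝ) • x - c‖ :=
          (norm_add_le _ _).trans (add_le_add le_rfl (φ.le_opNorm _))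
        _ ≤ C + ‖φ‖ * 1 := by
          gcongr
          exact hφ c hc
        _ = C + ‖φ‖ := by rw [mul_one]
    rw [map_smul, norm_smul] at h2
    norm_num at h2
    linarith
  linarith

/-- The net is used twice: on the operator, then on each functional `x ↦ ⟨A y, x⟩` with `y` in the
net. -/
theorem bilinBound_of_net {n : ℕ} {χ : Fin n → Fin n → ℝ} {K : ℝ}
    {T : Finset (EuclideanSpace ℝ (Fin n))}
    (hT : ∀ x : EuclideanSpace ℝ (Fin n), ‖x‖ ≤ 2 → ∃ c ∈ T, ‖x - c‖ ≤ 1)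
    (h : ∀ x ∈ T, ∀ y ∈ T, |∑ i, ∑ j, χ i j * (x i * y j)| ≤ K) : BilinBound χ K := by
  let A : EuclideanSpace ℝ (Fin n) →L[ℝ] EuclideanSpace ℝ (Fin n) :=
    Matrix.toEuclideanCLM (𝕜 := ℝ) (Matrix.of χ)
  have hA : ∀ x y : EuclideanSpace ℝ (Fin n),
      inner ℝ x (A y) = ∑ i, ∑ j, χ i j * (x i * y j) := by
    intro x y
    simp only [A, PiLp.inner_apply, RCLike.inner_apply, conj_trivial,
      Matrix.ofLp_toEuclideanCLM, Matrix.mulVec, dotProduct, Matrix.of_apply, Finset.sum_mul]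
    exact Finset.sum_congr rfl fun i _ => Finset.sum_congr rfl fun j _ => by ring
  have hAK : ‖A‖ ≤ K := by
    refine opNorm_le_of_net hT A fun y hy => ?_
    rw [← innerSL_apply_norm (𝕜 := ℝ)]
    refine opNorm_le_of_net hT _ fun x hx => ?_
    rw [innerSL_apply_apply, real_inner_comm, hA, Real.norm_eq_abs]
    exact h x hx y hy
  intro x y
  have h1 := abs_real_inner_le_norm (WithLp.toLp 2 x) (A (WithLp.toLp 2 y))
  rw [hA] at h1
  refine h1.trans ?_
  calc ‖WithLp.toLp 2 x‖ * ‖A (WithLp.toLp 2 y)‖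
      ≤ ‖WithLp.toLp 2 x‖ * (K * ‖WithLp.toLp 2 y‖) := by
        gcongr
        exact A.le_of_opNorm_le hAK _
    _ = K * (√(∑ i, x i ^ 2) * √(∑ j, y j ^ 2)) := by
        simp only [EuclideanSpace.norm_eq, Real.norm_eq_abs, sq_abs]
        ring

/-- Chernoff with coefficients scaled by `√n` gives the exponent `64 n / 2 - 37 n = -5 n`; the union
bound over two net points and a sign costs `2 * 25 ^ n ≤ 50 ^ n ≤ e ^ (4 n)`. -/
theorem randomGraph_not_bilinBound_le {n : ℕ} (hn1 : 1 ≤ n) :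
    (randomGraph n).real {G | ¬ BilinBound (edgeSign G) (37 * √n)} ≤ Real.exp (-n) := by
  obtain ⟨T, hTcard, hT2, hT⟩ := exists_net n
  have hsum : ∀ x : EuclideanSpace ℝ (Fin n), ‖x‖ ≤ 2 → ∑ i, x i ^ 2 ≤ 4 := by
    intro x hx
    have := EuclideanSpace.real_norm_sq_eq x
    nlinarith [norm_nonneg x]
  have hn0 : (0 : ℝ) ≤ √n := Real.sqrt_nonneg _
  have hnn : √(n : ℝ) * √n = n := Real.mul_self_sqrt (by positivity)
  have htail : ∀ x ∈ T, ∀ y ∈ T, ∀ σ : ℝ, σ ^ 2 = 1 →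
      (randomGraph n).real {G | 37 * √n ≤ σ * ∑ i, ∑ j, edgeSign G i j * (x i * y j)}
        ≤ Real.exp (-5 * n) := by
    intro x hx y hy σ hσ
    rcases Nat.eq_zero_or_pos n with rfl | hn
    · simp
    have hsn : 0 < √(n : ℝ) := Real.sqrt_pos.2 (by exact_mod_cast hn)
    have h1 := randomGraph_chernoff
      (fun e : Fin n × Fin n => √n * σ * (x e.1 * y e.2 + x e.2 * y e.1)) (37 * n)
    refine (measureReal_mono ?_).trans (h1.trans ?_)
    · intro G hG
      simp only [Set.mem_ofPred_eq] at hG ⊢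
      rw [sum_edgeSign_eq] at hG
      have h2 := mul_le_mul_of_nonneg_left hG hn0
      calc 37 * (n : ℝ) = √n * (37 * √n) := by linear_combination -37 * hnn
        _ ≤ _ := h2
        _ = _ := by
          rw [← mul_assoc, Finset.mul_sum]
          exact Finset.sum_congr rfl fun e _ => by ring
    · rw [Real.exp_le_exp]
      have h3 := sum_vertexPairs_sq_le x y
      have h4 : ∑ e ∈ vertexPairs n, (√n * σ * (x e.1 * y e.2 + x e.2 * y e.1)) ^ 2
          = n * ∑ e ∈ vertexPairs n, (x e.1 * y e.2 + x e.2 * y e.1) ^ 2 := by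
        rw [Finset.mul_sum]
        refine Finset.sum_congr rfl fun e _ => ?_
        rw [mul_pow, mul_pow, hσ, sq √(n : ℝ), hnn, mul_one]
      rw [h4]
      have h5 : (∑ i, x i ^ 2) * ∑ j, y j ^ 2 ≤ 4 * 4 :=
        mul_le_mul (hsum x (hT2 x hx)) (hsum y (hT2 y hy))
          (Finset.sum_nonneg fun _ _ => sq_nonneg _) (by norm_num)
      have hn' : (0 : ℝ) ≤ n := by positivity
      nlinarith
  have hsub : {G : SimpleGraph (Fin n) | ¬ BilinBound (edgeSign G) (37 * √n)} ⊆
      ⋃ q ∈ T ×ˢ T ×ˢ ({1, -1} : Finset ℝ),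
        {G | 37 * √n ≤ q.2.2 * ∑ i, ∑ j, edgeSign G i j * (q.1 i * q.2.1 j)} := by
    intro G hG
    by_contra hc
    refine hG (bilinBound_of_net hT fun x hx y hy => ?_)
    simp only [Set.mem_iUnion, not_exists, Set.mem_ofPred_eq, not_le] at hc
    have h1 := hc (x, y, 1) (by simp [hx, hy])
    have h2 := hc (x, y, -1) (by simp [hx, hy])
    rw [abs_le]
    constructor <;> linarith
  refine (measureReal_mono hsub (measure_ne_top _ _)).trans ((measureReal_biUnion_finset_le _ _).trans ?_)
  calc _ ≤ ∑ _q ∈ T ×ˢ T ×ˢ ({1, -1} : Finset ℝ), Real.exp (-5 * n) := by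
        refine Finset.sum_le_sum fun q hq => ?_
        simp only [Finset.mem_product, Finset.mem_insert, Finset.mem_singleton] at hq
        refine htail _ hq.1 _ hq.2.1 _ ?_
        rcases hq.2.2 with h | h <;> rw [h] <;> norm_num
    _ = (T.card * (T.card * 2)) * Real.exp (-5 * n) := by
        rw [Finset.sum_const, Finset.card_product, Finset.card_product,
          Finset.card_pair (by norm_num)]
        simp
    _ ≤ ((5 ^ n) * ((5 ^ n) * 2)) * Real.exp (-5 * n) := by
        have : (T.card : ℝ) ≤ 5 ^ n := by exact_mod_cast hTcard
        gcongr
    _ ≤ Real.exp (-n) := by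
        have h50 : (50 : ℝ) ≤ Real.exp 4 := by
          have h := Real.exp_one_gt_d9
          have e : Real.exp 4 = Real.exp 1 ^ 4 := by rw [← Real.exp_nat_mul]; norm_num
          rw [e]
          calc (50 : ℝ) ≤ 2.7 ^ 4 := by norm_num
            _ ≤ Real.exp 1 ^ 4 := by gcongr; linarith
        have h2 : (2 : ℝ) ≤ 2 ^ n := by simpa using pow_le_pow_right₀ (one_le_two (α := ℝ)) hn1
        calc (5 : ℝ) ^ n * (5 ^ n * 2) * Real.exp (-5 * n)
            ≤ 5 ^ n * (5 ^ n * 2 ^ n) * Real.exp (-5 * n) := by gcongr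
          _ = 50 ^ n * Real.exp (-5 * n) := by rw [← mul_pow, ← mul_pow]; norm_num
          _ ≤ Real.exp 4 ^ n * Real.exp (-5 * n) := by gcongr
          _ = Real.exp (-n) := by
            rw [← Real.exp_nat_mul, ← Real.exp_add]
            ring_nf

theorem sum_edgeSign_clique {n : ℕ} {G : SimpleGraph (Fin n)} {S : Finset (Fin n)}
    (hS : G.IsClique (S : Set (Fin n))) :
    ∑ e ∈ vertexPairs n, (if e.1 ∈ S ∧ e.2 ∈ S then (1 : ℝ) else 0) * edgeSign G e.1 e.2
      = ∑ e ∈ vertexPairs n, if e.1 ∈ S ∧ e.2 ∈ S then (1 : ℝ) else 0 := by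
  refine Finset.sum_congr rfl fun e he => ?_
  have he := (Finset.mem_filter.1 he).2
  split_ifs with h
  · have := hS h.1 h.2 he.ne
    simp [edgeSign, he.ne, this]
  · simp

theorem card_pairs_in {n : ℕ} (S : Finset (Fin n)) :
    ∑ e ∈ vertexPairs n, (if e.1 ∈ S ∧ e.2 ∈ S then (1 : ℝ) else 0)
      = S.card * (S.card - 1) / 2 := by
  -- In the complete graph all signs are `1`, so the bilinear form of an indicator counts ordered
  -- pairs.
  have h1 := sum_edgeSign_eq (⊤ : SimpleGraph (Fin n))
    (fun i => if i ∈ S then 1 else 0) (fun i => if i ∈ S then 1 else 0)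
  have h2 : ∑ i, ∑ j, edgeSign (⊤ : SimpleGraph (Fin n)) i j *
      ((if i ∈ S then (1 : ℝ) else 0) * (if j ∈ S then 1 else 0)) = S.card * S.card - S.card := by
    have h3 : ∀ i j, edgeSign (⊤ : SimpleGraph (Fin n)) i j *
        ((if i ∈ S then (1 : ℝ) else 0) * (if j ∈ S then 1 else 0))
        = (if i ∈ S then 1 else 0) * (if j ∈ S then 1 else 0)
          - if i = j then (if i ∈ S then 1 else 0) else 0 := by
      intro i j
      by_cases hij : i = j
      · subst hij
        by_cases hi : i ∈ S <;> simp [edgeSign_self, hi]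
      · simp [edgeSign, hij]
    simp_rw [h3, Finset.sum_sub_distrib, ← Finset.mul_sum, ← Finset.sum_mul]
    simp
  have h4 : ∀ e ∈ vertexPairs n,
      ((if e.1 ∈ S then (1 : ℝ) else 0) * (if e.2 ∈ S then 1 else 0) +
        (if e.2 ∈ S then 1 else 0) * (if e.1 ∈ S then 1 else 0)) *
        edgeSign (⊤ : SimpleGraph (Fin n)) e.1 e.2
        = 2 * if e.1 ∈ S ∧ e.2 ∈ S then (1 : ℝ) else 0 := by
    intro e he
    have he := (Finset.mem_filter.1 he).2
    by_cases h1 : e.1 ∈ S <;> by_cases h2 : e.2 ∈ S <;> simp [edgeSign, he.ne, h1, h2]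
    norm_num
  rw [h2, Finset.sum_congr rfl h4, ← Finset.mul_sum] at h1
  linarith

theorem randomGraph_clique_le {n : ℕ} (S : Finset (Fin n)) :
    (randomGraph n).real {G | G.IsClique (S : Set (Fin n))}
      ≤ Real.exp (-(S.card * (S.card - 1) / 4)) := by
  have h := randomGraph_chernoff
    (fun e : Fin n × Fin n => if e.1 ∈ S ∧ e.2 ∈ S then (1 : ℝ) else 0)
    (S.card * (S.card - 1) / 2)
  refine (measureReal_mono ?_).trans (h.trans ?_)
  · intro G hG
    simp only [Set.mem_ofPred_eq] at hG ⊢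
    rw [sum_edgeSign_clique hG, card_pairs_in]
  · rw [Real.exp_le_exp]
    have : ∀ e : Fin n × Fin n, (if e.1 ∈ S ∧ e.2 ∈ S then (1 : ℝ) else 0) ^ 2
        = if e.1 ∈ S ∧ e.2 ∈ S then (1 : ℝ) else 0 := by
      intro e
      split_ifs <;> norm_num
    simp only [this, card_pairs_in]
    linarith

theorem randomGraph_cliqueNum_le {n m : ℕ} (hn : 1 ≤ n) (hm : 1 ≤ m)
    (hnm : 8 * Real.log n + 1 ≤ m) :
    (randomGraph n).real {G | m ≤ G.cliqueNum} ≤ 1 / n := by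
  classical
  have hn0 : (0 : ℝ) < n := by exact_mod_cast hn
  have hm1 : (1 : ℝ) ≤ m := by exact_mod_cast hm
  have hlog : 0 ≤ Real.log n := Real.log_nonneg (by exact_mod_cast hn)
  have hsub : {G : SimpleGraph (Fin n) | m ≤ G.cliqueNum} ⊆
      ⋃ S ∈ (Finset.univ : Finset (Fin n)).powersetCard m, {G | G.IsClique (S : Set (Fin n))} := by
    intro G hG
    obtain ⟨s, hs⟩ := G.exists_isNClique_cliqueNum
    obtain ⟨S, hSs, hS⟩ := Finset.exists_subset_card_eq (show m ≤ s.card by rw [hs.card_eq]; exact hG)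
    simp only [Set.mem_iUnion, Finset.mem_powersetCard_univ]
    exact ⟨S, hS, hs.isClique.subset (by exact_mod_cast hSs)⟩
  refine (measureReal_mono hsub (measure_ne_top _ _)).trans ((measureReal_biUnion_finset_le _ _).trans ?_)
  calc _ ≤ ∑ _S ∈ (Finset.univ : Finset (Fin n)).powersetCard m,
          Real.exp (-(m * (m - 1) / 4)) := by
        refine Finset.sum_le_sum fun S hS => ?_
        have := randomGraph_clique_le S
        rwa [Finset.mem_powersetCard_univ.1 hS] at this
    _ = n.choose m * Real.exp (-(m * (m - 1) / 4)) := by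
        simp
    _ ≤ n ^ m * Real.exp (-(m * (m - 1) / 4)) := by
        gcongr
        exact_mod_cast Nat.choose_le_pow n m
    _ = Real.exp (m * Real.log n - m * (m - 1) / 4) := by
        rw [sub_eq_add_neg (m * Real.log n), Real.exp_add, Real.exp_nat_mul, Real.exp_log hn0]
    _ ≤ Real.exp (-Real.log n) := by
        rw [Real.exp_le_exp]
        -- As `m - 1 ≥ 8 log n`, the exponent is at most `m log n - 2 m log n ≤ -log n`.
        nlinarith
    _ = 1 / n := by rw [Real.exp_neg, Real.exp_log hn0, one_div]

end RandomGraph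

/-! ### The gap on the planted graph -/

section PlantedClique

theorem plantedClique_real_ge {n t : ℕ} (ht : t ≤ n) {a : ℝ} {E : Set (SimpleGraph (Fin n))}
    (h : ∀ S : Finset (Fin n), S.card = t →
      a ≤ (randomGraph n).real {G | G ⊔ cliqueOn S ∈ E}) :
    a ≤ (plantedClique n t).real E := by
  have := isProbabilityMeasure_plantedClique ht
  have h0 : (n.choose t : ℝ≥0∞) ≠ 0 := by exact_mod_cast (Nat.choose_pos ht).ne'
  rw [measureReal_def, ← ENNReal.ofReal_le_iff_le_toReal (measure_ne_top _ _)]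
  have hS : ∀ S ∈ (Finset.univ : Finset (Fin n)).powersetCard t,
      ENNReal.ofReal a ≤ (randomGraph n).map (fun G => G ⊔ cliqueOn S) E := by
    intro S hS
    rw [Measure.map_apply (measurable_of_finite _) (.of_discrete),
      ENNReal.ofReal_le_iff_le_toReal (measure_ne_top _ _)]
    exact h S (Finset.mem_powersetCard_univ.1 hS)
  calc ENNReal.ofReal a
      = (n.choose t : ℝ≥0∞)⁻¹ *
        ∑ _S ∈ (Finset.univ : Finset (Fin n)).powersetCard t, ENNReal.ofReal a := by
        rw [Finset.sum_const, Finset.card_powersetCard, Finset.card_univ, Fintype.card_fin,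
          nsmul_eq_mul, ← mul_assoc, ENNReal.inv_mul_cancel h0 (by simp), one_mul]
    _ ≤ (n.choose t : ℝ≥0∞)⁻¹ * ∑ S ∈ (Finset.univ : Finset (Fin n)).powersetCard t,
          (randomGraph n).map (fun G => G ⊔ cliqueOn S) E := by
        gcongr with S hS'
        exact hS S hS'
    _ = plantedClique n t E := by
        simp only [plantedClique, Measure.smul_apply, Measure.finsetSum_apply, smul_eq_mul]

theorem gap_of_bilinBound {n r d : ℕ} (hn : 1 ≤ n) (hr : 1 ≤ r) {G : SimpleGraph (Fin n)}
    (hK : BilinBound (edgeSign G) (37 * √n)) (hlog : 9 ≤ Real.log n)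
    (hω : (G.cliqueNum : ℝ) ≤ 8 * Real.log n + 1) {S : Finset (Fin n)} (hS : 1 ≤ S.card) :
    (n : ℝ) ^ (1 / (2 * (r : ℝ))) / ((S.card : ℝ) * (2 ^ 17) ^ r * Real.log n ^ 2)
      ≤ sosCliqueGap (G ⊔ cliqueOn S) r d := by
  have : Nonempty (Fin n) := ⟨⟨0, hn⟩⟩
  set x : ℝ := (n : ℝ) ^ (1 / (2 * (r : ℝ))) with hx
  set L := Real.log n with hL
  have hr0 : (0 : ℝ) < r := by exact_mod_cast hr
  have hS1 : (1 : ℝ) ≤ S.card := by exact_mod_cast hS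
  have hn1 : (1 : ℝ) ≤ n := by exact_mod_cast hn
  have hL2 : 8 * L + 2 ≤ L ^ 2 := by nlinarith
  have hL1 : 1 ≤ L ^ 2 := by nlinarith
  have hden : 0 < (S.card : ℝ) * (2 ^ 17) ^ r * L ^ 2 := by positivity
  have hxr : x ^ r = √n := by
    rw [hx, ← Real.rpow_natCast, ← Real.rpow_mul (by positivity), Real.sqrt_eq_rpow]
    congr 1
    field_simp
  -- If the claimed bound is at most `1`, it follows from the gap being at least `1`; otherwise `x`
  -- is large enough for `k ≥ 1` below.
  rcases le_or_gt x ((S.card : ℝ) * (2 ^ 17) ^ r * L ^ 2) with hsmall | hbig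
  · exact ((div_le_one hden).2 hsmall).trans (one_le_sosCliqueGap _ hr d)
  set k := x / (2 ^ 17) ^ r with hk
  have hCr : (1 : ℝ) ≤ (2 ^ 17) ^ r := one_le_pow₀ (by norm_num)
  have hxC : (2 ^ 17) ^ r ≤ x := by
    refine le_trans ?_ hbig.le
    rw [mul_right_comm]
    refine le_mul_of_one_le_left (by positivity) ?_
    nlinarith
  have hx1 : 1 ≤ x := hCr.trans hxC
  have hk1 : 1 ≤ k := (one_le_div (by positivity)).2 hxC
  have hsn : √(n : ℝ) * √n = n := Real.mul_self_sqrt (by positivity)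
  have hsn1 : 1 ≤ √(n : ℝ) := Real.one_le_sqrt.2 hn1
  have hmem : k ∈ sosCliqueObjectives G r d := by
    refine exists_isSOSCliqueSolution hr (K := 37 * √n) hk1 ?_ (by positivity) hK ?_ d
    · rw [Fintype.card_fin]
      calc k * 4 ^ r ≤ k * (2 ^ 17) ^ r := by gcongr; norm_num
        _ = x := by rw [hk]; field_simp
        _ ≤ x ^ r := le_self_pow₀ hx1 (by omega)
        _ = √n := hxr
        _ ≤ n := by nlinarith
    · rw [Fintype.card_fin, hk, div_pow, hxr]
      -- Here `k ^ r = √n / 2 ^ (17 r ^ 2)`. The constant `17` comes from `10 + 5 r + 2 r ^ 2 ≤ 17 r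
      -- ^ 2`, an equality at `r = 1`.
      have hnum : 37 * (18 * (r : ℝ) * 2 ^ (2 * r ^ 2 + 4 * r)) ≤ ((2 ^ 17) ^ r) ^ r := by
        have h1 : (r : ℝ) ≤ 2 ^ r := by exact_mod_cast (Nat.lt_two_pow_self).le
        calc 37 * (18 * (r : ℝ) * 2 ^ (2 * r ^ 2 + 4 * r))
            ≤ 2 ^ 10 * (2 ^ r * 2 ^ (2 * r ^ 2 + 4 * r)) := by
              have : (0 : ℝ) < 2 ^ (2 * r ^ 2 + 4 * r) := by positivity
              nlinarith [mul_le_mul_of_nonneg_right h1 this.le]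
          _ = 2 ^ (10 + (r + (2 * r ^ 2 + 4 * r))) := by rw [← pow_add, ← pow_add]
          _ ≤ 2 ^ (17 * r * r) := by
              refine pow_le_pow_right₀ (by norm_num) ?_
              nlinarith
          _ = _ := by rw [pow_mul, pow_mul]
      calc 37 * √n * (18 * (r : ℝ) * 2 ^ (2 * r ^ 2 + 4 * r)) * (√n / ((2 ^ 17) ^ r) ^ r)
          = (37 * (18 * (r : ℝ) * 2 ^ (2 * r ^ 2 + 4 * r))) / ((2 ^ 17) ^ r) ^ r *
            (√n * √n) := by ring
        _ ≤ 1 * (√n * √n) := by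
            gcongr
            exact (div_le_one (by positivity)).2 hnum
        _ = n := by rw [one_mul, hsn]
  have hval : k ≤ sosCliqueValue (G ⊔ cliqueOn S) r d :=
    le_csSup (sosCliqueObjectives_bddAbove _ hr d)
      (sosCliqueObjectives_mono le_sup_left r d hmem)
  have hω0 : (0 : ℝ) < (G ⊔ cliqueOn S).cliqueNum := by exact_mod_cast one_le_cliqueNum _
  have hω1 : ((G ⊔ cliqueOn S).cliqueNum : ℝ) ≤ S.card * L ^ 2 := by
    have h1 : ((G ⊔ cliqueOn S).cliqueNum : ℝ) ≤ G.cliqueNum + S.card := by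
      exact_mod_cast cliqueNum_sup_cliqueOn_le G S
    nlinarith
  calc x / ((S.card : ℝ) * (2 ^ 17) ^ r * L ^ 2) = k / (S.card * L ^ 2) := by
        rw [hk]
        field_simp
    _ ≤ k / (G ⊔ cliqueOn S).cliqueNum := by gcongr
    _ ≤ sosCliqueGap (G ⊔ cliqueOn S) r d := by
        rw [sosCliqueGap]
        gcongr

theorem randomGraph_good_ge {n : ℕ} (hn : 1 ≤ n) :
    1 - 2 / n ≤ (randomGraph n).real {G | BilinBound (edgeSign G) (37 * √n) ∧
      (G.cliqueNum : ℝ) ≤ 8 * Real.log n + 1} := by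
  have hn0 : (0 : ℝ) < n := by exact_mod_cast hn
  have hlog : 0 ≤ Real.log n := Real.log_nonneg (by exact_mod_cast hn)
  set A := {G : SimpleGraph (Fin n) | BilinBound (edgeSign G) (37 * √n) ∧
      (G.cliqueNum : ℝ) ≤ 8 * Real.log n + 1} with hA
  set m := ⌈8 * Real.log n + 1⌉₊ with hm
  have hm1 : 8 * Real.log n + 1 ≤ m := Nat.le_ceil _
  have h1 := randomGraph_not_bilinBound_le hn
  have h2 := randomGraph_cliqueNum_le (m := m) hn
    (Nat.one_le_ceil_iff.2 (by positivity)) hm1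
  have h3 : (randomGraph n).real Aᶜ ≤ 2 / n := by
    have hsub : Aᶜ ⊆ {G | ¬ BilinBound (edgeSign G) (37 * √n)} ∪ {G | m ≤ G.cliqueNum} := by
      intro G hG
      simp only [hA, Set.mem_compl_iff, Set.mem_ofPred_eq, not_and_or, not_le] at hG
      rcases hG with h | h
      · exact Or.inl h
      · exact Or.inr (Nat.ceil_le.2 h.le)
    refine (measureReal_mono hsub (measure_ne_top _ _)).trans
      ((measureReal_union_le _ _).trans ?_)
    have h4 : Real.exp (-n) ≤ 1 / n := by
      rw [Real.exp_neg, ← one_div]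
      have := Real.add_one_le_exp (n : ℝ)
      gcongr
      linarith
    calc _ ≤ 1 / (n : ℝ) + 1 / n := add_le_add (h1.trans h4) h2
      _ = 2 / n := by ring
  have h5 := probReal_compl_eq_one_sub (μ := randomGraph n) (s := A) .of_discrete
  linarith

end PlantedClique

theorem corollary1p2 :
    ∃ C : ℝ, 0 < C ∧ ∀ ε : ℝ, 0 < ε → ∃ N : ℕ, ∀ n : ℕ, N ≤ n →
      ∀ r : ℕ, 1 ≤ r → ∀ d : ℕ, r ≤ d → ∀ t : ℕ, 1 ≤ t → t ≤ n →
        1 - ε ≤ (plantedClique n t).real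
          {G : SimpleGraph (Fin n) |
            (n : ℝ) ^ (1 / (2 * (r : ℝ))) / ((t : ℝ) * C ^ r * Real.log n ^ 2)
              ≤ sosCliqueGap G r d} := by
  refine ⟨2 ^ 17, by norm_num, fun ε hε => ?_⟩
  -- `exp 9` ensures `log n ≥ 9`, so that `8 log n + 2 ≤ (log n) ^ 2`; `2 / ε` makes the failure
  -- probability `2 / n` at most `ε`.
  refine ⟨max 1 (max ⌈Real.exp 9⌉₊ ⌈2 / ε⌉₊), fun n hn r hr d _ t ht htn => ?_⟩
  have hn1 : 1 ≤ n := (le_max_left _ _).trans hn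
  have hn0 : (0 : ℝ) < n := by exact_mod_cast hn1
  have hn2 : Real.exp 9 ≤ n :=
    Nat.ceil_le.1 ((le_max_left _ _).trans ((le_max_right _ _).trans hn))
  have hn3 : 2 / ε ≤ n :=
    Nat.ceil_le.1 ((le_max_right _ _).trans ((le_max_right _ _).trans hn))
  have hlog : 9 ≤ Real.log n := (Real.le_log_iff_exp_le hn0).2 hn2
  refine plantedClique_real_ge htn fun S hS => ?_
  have hε' : 2 / (n : ℝ) ≤ ε := by
    rw [div_le_iff₀ hε] at hn3
    rw [div_le_iff₀ hn0]
    linarith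
  refine le_trans (by linarith) ((randomGraph_good_ge hn1).trans
    (measureReal_mono ?_ (measure_ne_top _ _)))
  rintro G ⟨hK, hω⟩
  simp only [Set.mem_ofPred_eq]
  rw [← hS]
  exact gap_of_bilinBound hn1 hr hK hlog hω (by omega)
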